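/- **Theorem 4.1.** Let $\alpha\in(0,1)$, let $(Y,X)$ take values in $\mathbb R\times\mathbb R^p$, and let $(Y_1,X_1),\dots,(Y_n,X_n)$ be i.i.d. copies of $(Y,X)$. Assume the joint linear model: almost surely $$Q_\alpha(Y\mid X)=X^{\mathsf T}\beta^*,\qquad \mathrm{ES}_\alpha(Y\mid X):=\mathbb E\{Y\mid Y\le Q_\alpha(Y\mid X),\,X\}=X^{\mathsf T}\theta^*$$ for some $\beta^*,\theta^*\in\mathbb R^p$, where $Q_\alpha$ is the conditional $\alpha$-quantile and the conditional expected shortfall exists. Put $\varepsilon=Y-X^{\mathsf T}\beta^*$, $\Sigma=\mathbb E(XX^{\mathsf T})$, $W=\Sigma^{-1/2}X$, $\|u\|_\Sigma=\|\Sigma^{1/2}u\|_2$ and $\kappa_l=\sup_{\|u\|_2=1}\mathbb E|u^{\mathsf T}W|^l$. Assume further: * (density/variance condition) almost surely over $X$, the conditional distribution function $F_{\varepsilon\mid X}$ is continuously differentiable, $|F_{\varepsilon\mid X}(t)-F_{\varepsilon\mid X}(0)|\le\bar f\,|t|$ for all $t\in\mathbb R$, and $\varepsilon_-=\min(\varepsilon,0)$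 has finite conditional variance $\mathrm{var}(\varepsilon_-\mid X)\le\bar\sigma^2$, where $\bar\sigma\ge0$; * (sub-Gaussian covariates) $\Sigma$ is positive definite and, for some $\upsilon_1\ge1$, $\mathbb P(|u^{\mathsf T}W|\ge\upsilon_1t)\le2e^{-t^2/2}$ for all $t\ge0$ and all $u$ with $\|u\|_2=1$. Let $(\hat\beta,\hat\theta)$ be the two-step estimator: $$\hat\beta\in\arg\min_{\beta\in\mathbb R^p}\frac1n\sum_{i=1}^n\rho_\alpha(Y_i-X_i^{\mathsf T}\beta),\qquad \hat\theta\in\arg\min_{\theta\in\mathbb R^p}\frac1n\sum_{i=1}^nS_i(\hat\beta,\theta)^2,$$ where $\rho_\alpha(u)=\{\alpha-\mathbf 1(u<0)\}u$ and $$S_i(\beta,\theta)=\alpha X_i^{\mathsf T}\theta-\mathbf 1(Y_i\le X_i^{\mathsf T}\beta)\,Y_i+\{\mathbf 1(Y_i\le X_i^{\mathsf T}\beta)-\alpha\}X_i^{\mathsf T}\beta.$$ Then there are absolute constants $C_1,C_2>0$ (not depending on $n$, $p$, $\alpha$, the distribution, or any other quantity above) such that for all $r_0>0$ and $\delta\in(0,1/3]$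 with $n\ge C_2\,\kappa_4\{p+2\log(2/\delta)\}$, the following holds with probability at least $1-3\delta$: if $\|\hat\beta-\beta^*\|_\Sigma\le r_0$, then $$\alpha\|\hat\theta-\theta^*\|_\Sigma\le2\bar\sigma\sqrt{\frac{p}{n\delta}}+\bar f\,\kappa_3\,r_0^2+C_1\upsilon_1^2\sqrt{\frac{p+\log(1/\delta)}{n}}\;r_0.$$ That is, the probability that $\|\hat\beta-\beta^*\|_\Sigma\le r_0$ and the bound fails is at most $3\delta$. -/

import Mathlib

open MeasureTheory ProbabilityTheory Set
open scoped MatrixOrder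

noncomputable section

namespace ESReg

/-- The space of covariates and coefficients, `ℝᵖ` with the Euclidean norm. -/
abbrev Vec (p : ℕ) : Type := EuclideanSpace ℝ (Fin p)

/-- The product `A u` of a matrix and a Euclidean vector. -/
def mulVecE {p : ℕ} (A : Matrix (Fin p) (Fin p) ℝ) (u : Vec p) : Vec p :=
  WithLp.toLp 2 (A.mulVec u.ofLp)

/-- `‖u‖_A = ‖A^{1/2} u‖₂` for a positive semidefinite matrix `A`. -/
def matNorm {p : ℕ} (A : Matrix (Fin p) (Fin p) ℝ) (u : Vec p) : ℝ :=
  ‖mulVecE (CFC.sqrt A) u‖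

section Population

/-! In this section `P` is the joint law of `(X, Y)` on `ℝᵖ × ℝ`; the conditional law of `Y` given
`X = x` is `P.condKernel x`, and `P.fst` is the law of `X`. -/

variable {p : ℕ} (P : Measure (Vec p × ℝ))

/-- `Σ = E (X Xᵀ)`. -/
def secondMoment : Matrix (Fin p) (Fin p) ℝ :=
  Matrix.of fun i j => ∫ z, z.1 i * z.1 j ∂P

/-- The standardized covariate `W = Σ^{-1/2} X`, as a function of `X = x`. -/
def standardize (x : Vec p) : Vec p :=
  mulVecE (CFC.sqrt (secondMoment P))⁻¹ x

/-- `κ_l = sup_{‖u‖ = 1} E |uᵀ W| ^ l`. -/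
def kappa (l : ℕ) : ℝ :=
  ⨆ u : Metric.sphere (0 : Vec p) 1, ∫ z, |inner ℝ (u : Vec p) (standardize P z.1)| ^ l ∂P

variable [IsFiniteMeasure P]

/-- The `α`-quantile `inf {y : F(y) ≥ α}` of a distribution `ν` on the line. -/
def quantile (ν : Measure ℝ) (α : ℝ) : ℝ :=
  sInf {y : ℝ | α ≤ ν.real (Iic y)}

/-- The lower `α`-expected shortfall `E (Y | Y ≤ Q_α(Y))` of a distribution `ν` on the line. -/
def expectedShortfall (ν : Measure ℝ) (α : ℝ) : ℝ :=
  ∫ y, y ∂(ν[|Iic (quantile ν α)])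

/-- The joint linear model: almost surely `Q_α(Y | X) = Xᵀ β*` and `ES_α(Y | X) = Xᵀ θ*`
(where the conditional expected shortfall exists). -/
def JointModel (α : ℝ) (βs θs : Vec p) : Prop :=
  ∀ᵐ x ∂P.fst,
    quantile (P.condKernel x) α = inner ℝ x βs ∧
    IntegrableOn (fun y : ℝ => y) (Iic (quantile (P.condKernel x) α)) (P.condKernel x) ∧
    expectedShortfall (P.condKernel x) α = inner ℝ x θs

/-- The conditional distribution function of `ε = Y - Xᵀ β*` given `X = x`. -/
def residualCDF (βs : Vec p) (x : Vec p) (t : ℝ) : ℝ :=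
  (P.condKernel x).real {y | y - inner ℝ x βs ≤ t}

/-- The condition on the conditional distribution of `ε = Y - Xᵀ β*` given `X`: almost surely its
distribution function is continuously differentiable with `|F(t) - F(0)| ≤ fbar |t|`, and
`ε₋ = min ε 0` has conditional variance at most `σbar ^ 2`. -/
def DensityCondition (βs : Vec p) (fbar σbar : ℝ) : Prop :=
  ∀ᵐ x ∂P.fst,
    ContDiff ℝ 1 (residualCDF P βs x) ∧
    (∀ t : ℝ, |residualCDF P βs x t - residualCDF P βs x 0| ≤ fbar * |t|) ∧
    MemLp (fun y : ℝ => min (y - inner ℝ x βs) 0) 2 (P.condKernel x) ∧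
    variance (fun y : ℝ => min (y - inner ℝ x βs) 0) (P.condKernel x) ≤ σbar ^ 2

/-- The covariates are sub-Gaussian with parameter `υ ≥ 1`, and `Σ` is positive definite. -/
def SubGaussianCovariates (υ : ℝ) : Prop :=
  1 ≤ υ ∧ (secondMoment P).PosDef ∧
    ∀ u : Vec p, ‖u‖ = 1 → ∀ t : ℝ, 0 ≤ t →
      P.real {z | υ * t ≤ |inner ℝ u (standardize P z.1)|} ≤ 2 * Real.exp (-t ^ 2 / 2)

end Population

section Estimators

/-! In this section `z i = (x_i, y_i)`, `i < n`, is an observed sample. -/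

variable {n p : ℕ}

/-- The check function `ρ_α(u) = (α - 1(u < 0)) u`. -/
def checkLoss (α u : ℝ) : ℝ :=
  (α - if u < 0 then 1 else 0) * u

/-- The empirical quantile regression loss. -/
def qrLoss (α : ℝ) (z : Fin n → Vec p × ℝ) (β : Vec p) : ℝ :=
  (1 / (n : ℝ)) * ∑ i, checkLoss α ((z i).2 - inner ℝ (z i).1 β)

/-- The orthogonal score
`S(β, θ; y, x) = α xᵀθ - 1(y ≤ xᵀβ) y + (1(y ≤ xᵀβ) - α) xᵀβ`. -/
def score (α : ℝ) (β θ : Vec p) (z : Vec p × ℝ) : ℝ :=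
  α * inner ℝ z.1 θ - (if z.2 ≤ inner ℝ z.1 β then 1 else 0) * z.2 +
    ((if z.2 ≤ inner ℝ z.1 β then 1 else 0) - α) * inner ℝ z.1 β

/-- The second-step least squares loss `(1/n) ∑ S_i(β, θ)²`. -/
def esLoss (α : ℝ) (z : Fin n → Vec p × ℝ) (β θ : Vec p) : ℝ :=
  (1 / (n : ℝ)) * ∑ i, score α β θ (z i) ^ 2

/-- `(βh, θh)` is a two-step estimate computed from the sample `z`: `βh` is a quantile regression
estimate, and `θh` minimizes the second-step loss at `β = βh`. -/
def IsTwoStepEstimate (α : ℝ) (z : Fin n → Vec p × ℝ) (βh θh : Vec p) : Prop :=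
  IsMinOn (qrLoss α z) univ βh ∧ IsMinOn (esLoss α z βh) univ θh

end Estimators

end ESReg

end

/-! The least-squares step is controlled through its normal equation. Write
$\omega=\varepsilon_--E(\varepsilon_-\mid X)$, $\eta=\Sigma^{1/2}(\hat\theta-\theta^*)$ and
$v=\Sigma^{1/2}(\hat\beta-\beta^*)/r_0$, so that $\|v\|\le1$ on the event considered. By `score_eq`
the score is $\alpha X^T(\hat\theta-\theta^*)$ minus the noise $\omega$ minus the effect
$r_0\varphi(v^TW)$ of replacing $\beta^*$ by $\hat\beta$, where $\varphi$ is random, 1-Lipschitz and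
zero at zero. Testing the normal equation against $u=\eta/\|\eta\|$ gives
$$\alpha\|\eta\|\sum_i(u^TW_i)^2=u^T\sum_i\omega_iW_i+r_0\,u^T\sum_i\varphi_i(v^TW_i)W_i.$$ What
remains is four estimates, combined in `ESReg.mul_matNorm_le`.

Curvature: the sum on the left is at least $n/2$ for all unit $u$ (`exists_half_le_sum_inner_sq`).
This is a PAC-Bayes argument with uniform laws on balls as priors and posteriors; a lower tail needs
only fourth moments.

Noise: $\omega$ is conditionally centred with variance at most $\bar\sigma^2$, so Chebyshev's
inequality suffices (`exists_norm_sum_sq_le`). Hence the factor $1/\sqrt\delta$.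

Bias: the conditional mean of the shift of the score by $s$ is $\int_0^s(\alpha-F(t))\,dt$. As
$F(0)=\alpha$, it is quadratic in $s$ (`abs_integral_scoreShift_le`). This orthogonality is why the
error of the first step enters as $r_0^2$.

Fluctuation: $\sum_i\varphi_i(v^TW_i)W_i$ is close to its mean uniformly in $\|v\|\le1$
(`exists_norm_sum_multSummand_le`). Difference quotients of this process, paired with a direction,
are sums of sub-exponential variables. Their exponential moments are integrated over direction and
endpoints in a ball of radius 2, so that Fubini and Markov give one good event. On that event a
deterministic chaining through means over shrinking balls (`norm_sub_le_of_lintegral_exp`) bounds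
all increments, with no nets and no suprema to measure. -/

noncomputable section

namespace ESReg

/-! ### Uniform laws on balls and deterministic chaining through ball means. -/

section BallMeasure

open Metric Filter Topology
open scoped ENNReal

variable {p : ℕ}

/-- The uniform distribution on an open ball. -/
def ballUnif (c : Vec p) (r : ℝ) : Measure (Vec p) := volume[|ball c r]

lemma isProbabilityMeasure_ballUnif (c : Vec p) {r : ℝ} (hr : 0 < r) :
    IsProbabilityMeasure (ballUnif c r) :=
  cond_isProbabilityMeasure_of_finite (measure_ball_pos _ _ hr).ne' measure_ball_lt_top.ne

lemma ballUnif_ae_mem (c : Vec p) (r : ℝ) : ∀ᵐ x ∂ballUnif c r, x ∈ ball c r :=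
  ae_cond_mem measurableSet_ball

lemma integrable_ballUnif {E : Type*} [NormedAddCommGroup E] {f : Vec p → E} (hf : Continuous f)
    (c : Vec p) {r : ℝ} (hr : 0 < r) : Integrable f (ballUnif c r) := by
  have := (hf.locallyIntegrable (μ := volume)).integrableOn_isCompact (isCompact_closedBall c r)
  exact (this.mono_set ball_subset_closedBall).smul_measure
    (ENNReal.inv_ne_top.2 (measure_ball_pos _ _ hr).ne')

/-- The ratio of the volumes is $(2/r)^p$. Its logarithm plays the part of the entropy term in both
the PAC-Bayes bound and the chaining. -/
lemma ballUnif_le (a : Vec p) {r : ℝ} (hr : 0 < r) (h : ‖a‖ + r ≤ 2) :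
    ballUnif a r ≤ ENNReal.ofReal ((2 / r) ^ p) • ballUnif (0 : Vec p) 2 := by
  have hV : volume (ball (0 : Vec p) 2) = ENNReal.ofReal ((2 / r) ^ p) * volume (ball a r) := by
    rw [Measure.addHaar_ball_of_pos _ _ hr, Measure.addHaar_ball_of_pos _ _ two_pos, ← mul_assoc,
      ← ENNReal.ofReal_mul (by positivity)]
    congr 2
    rw [finrank_euclideanSpace_fin, div_pow, div_mul_cancel₀ _ (by positivity)]
  have h0 : volume (ball a r) ≠ 0 := (measure_ball_pos _ _ hr).ne'
  have hc : ENNReal.ofReal ((2 / r) ^ p) * (volume (ball (0 : Vec p) 2))⁻¹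
      = (volume (ball a r))⁻¹ := by
    rw [hV, ENNReal.mul_inv (by left; simp; positivity) (by left; simp), ← mul_assoc,
      ENNReal.mul_inv_cancel (by simp; positivity) (by simp), one_mul]
  rw [ballUnif, ballUnif, ProbabilityTheory.cond, ProbabilityTheory.cond, smul_smul, hc]
  gcongr
  intro x hx
  have := norm_add_le (x - a) a
  rw [mem_ball_iff_norm] at hx ⊢
  simp only [sub_add_cancel, sub_zero] at *
  linarith

lemma lintegral_ballUnif_le (a : Vec p) {r : ℝ} (hr : 0 < r) (h : ‖a‖ + r ≤ 2)
    (f : Vec p → ℝ≥0∞) :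
    ∫⁻ x, f x ∂ballUnif a r ≤
      ENNReal.ofReal ((2 / r) ^ p) * ∫⁻ x, f x ∂ballUnif (0 : Vec p) 2 := by
  refine (lintegral_mono' (ballUnif_le a hr h) le_rfl).trans_eq ?_
  rw [lintegral_smul_measure, smul_eq_mul]

lemma ballUnif_map_sub_left (c d : Vec p) (r : ℝ) :
    MeasurePreserving (fun x => d - x) (ballUnif c r) (ballUnif (d - c) r) := by
  have h1 := (volume : Measure (Vec p)).measurePreserving_sub_left d
  have h2 := h1.restrict_preimage (s := ball (d - c) r) measurableSet_ball
  have h3 : (fun x => d - x) ⁻¹' ball (d - c) r = ball c r := by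
    ext x; simp [mem_ball, dist_eq_norm, norm_sub_rev]
  rw [h3] at h2
  have h4 : volume (ball (d - c) r) = volume (ball c r) := by
    rw [Measure.addHaar_ball_center, Measure.addHaar_ball_center volume c]
  rw [ballUnif, ballUnif, ProbabilityTheory.cond, ProbabilityTheory.cond, h4]
  exact h2.smul_measure _

/-- The point reflection $x\mapsto 2c-x$ preserves the law, so the mean is its fixed point. -/
lemma ballUnif_integral_id (c : Vec p) {r : ℝ} (hr : 0 < r) : ∫ x, x ∂ballUnif c r = c := by
  have := isProbabilityMeasure_ballUnif c hr
  have h := ballUnif_map_sub_left c (c + c) r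
  rw [add_sub_cancel_right] at h
  have h1 := h.integral_comp (MeasurableEquiv.subLeft (c + c)).measurableEmbedding
    (fun x => x)
  rw [integral_sub (integrable_const _) (integrable_ballUnif continuous_id' c hr)] at h1
  simp only [integral_const, probReal_univ, one_smul] at h1
  have h2 : (2 : ℝ) • ∫ x, x ∂ballUnif c r = (2 : ℝ) • c := by
    rw [two_smul, two_smul]
    exact (sub_eq_iff_eq_add.1 h1).symm
  exact smul_right_injective _ two_ne_zero h2

lemma integral_inner_ballUnif (c w : Vec p) {r : ℝ} (hr : 0 < r) :
    ∫ x, inner ℝ x w ∂ballUnif c r = inner ℝ c w := by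
  simp_rw [real_inner_comm w]
  rw [integral_inner (integrable_ballUnif continuous_id' c hr) w, ballUnif_integral_id c hr]

/-- The reflection in the hyperplane orthogonal to $v-w$ sends $v$ to $w$ and preserves the ball. -/
lemma integral_inner_sq_eq_of_norm_eq {v w : Vec p} (h : ‖v‖ = ‖w‖) :
    ∫ x, inner ℝ x v ^ 2 ∂ballUnif (0 : Vec p) 1 = ∫ x, inner ℝ x w ^ 2 ∂ballUnif (0 : Vec p) 1 := by
  set e := (ℝ ∙ (v - w))ᗮ.reflection with he
  have hev : e v = w := Submodule.reflection_sub h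
  have h2 := e.measurePreserving.restrict_preimage (s := ball (0 : Vec p) 1) measurableSet_ball
  have h3 : e ⁻¹' ball (0 : Vec p) 1 = ball (0 : Vec p) 1 := by
    ext x
    rw [mem_preimage, mem_ball_zero_iff, mem_ball_zero_iff, e.norm_map]
  rw [h3] at h2
  have h4 : MeasurePreserving e (ballUnif (0 : Vec p) 1) (ballUnif (0 : Vec p) 1) := by
    rw [ballUnif, ProbabilityTheory.cond]
    exact h2.smul_measure _
  symm
  rw [← h4.integral_comp e.toHomeomorph.measurableEmbedding]
  refine integral_congr_ae (.of_forall fun x => ?_)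
  simp only [← hev]
  exact congrArg (· ^ 2) (e.inner_map_map x v)

/-- The second moment of the uniform distribution on the unit ball is a multiple of the
identity. -/
lemma exists_integral_inner_sq (hp : 0 < p) :
    ∃ c : ℝ, 0 ≤ c ∧ c * p ≤ 1 ∧
      ∀ w : Vec p, ∫ x, inner ℝ x w ^ 2 ∂ballUnif (0 : Vec p) 1 = c * ‖w‖ ^ 2 := by
  have := isProbabilityMeasure_ballUnif (0 : Vec p) one_pos
  have hp' : (0 : ℝ) < p := by exact_mod_cast hp
  refine ⟨(∫ x, ‖x‖ ^ 2 ∂ballUnif (0 : Vec p) 1) / p, by positivity, ?_, fun w => ?_⟩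
  · rw [div_mul_cancel₀ _ hp'.ne']
    have h1 : ∫ x, ‖x‖ ^ 2 ∂ballUnif (0 : Vec p) 1 ≤ ∫ x, (1 : ℝ) ∂ballUnif (0 : Vec p) 1 := by
      refine integral_mono_ae (integrable_ballUnif (by fun_prop) _ one_pos) (integrable_const _) ?_
      filter_upwards [ballUnif_ae_mem (0 : Vec p) 1] with x hx
      rw [mem_ball_zero_iff] at hx
      exact pow_le_one₀ (norm_nonneg _) hx.le
    simpa using h1
  · have h1 : ∀ j : Fin p, ∫ x, inner ℝ x w ^ 2 ∂ballUnif (0 : Vec p) 1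
        = ‖w‖ ^ 2 * ∫ x, x j ^ 2 ∂ballUnif (0 : Vec p) 1 := fun j => by
      rw [integral_inner_sq_eq_of_norm_eq (w := ‖w‖ • EuclideanSpace.single j (1 : ℝ))
        (by simp [norm_smul]), ← integral_const_mul]
      congr with x
      rw [inner_smul_right, EuclideanSpace.inner_single_right]
      simp [mul_pow]
    have h2 : ∫ x, ‖x‖ ^ 2 ∂ballUnif (0 : Vec p) 1
        = ∑ j, ∫ x, x j ^ 2 ∂ballUnif (0 : Vec p) 1 := by
      rw [← integral_finsetSum _ fun j _ => integrable_ballUnif (by fun_prop) _ one_pos]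
      congr with x
      rw [EuclideanSpace.real_norm_sq_eq]
    have h3 : (p : ℝ) * ∫ x, inner ℝ x w ^ 2 ∂ballUnif (0 : Vec p) 1
        = ‖w‖ ^ 2 * ∫ x, ‖x‖ ^ 2 ∂ballUnif (0 : Vec p) 1 := by
      rw [h2, Finset.mul_sum, ← Finset.sum_congr rfl fun j _ => h1 j]
      simp
    field_simp
    linarith

lemma integral_inner_sq_ballUnif {c : ℝ}
    (hc : ∀ w : Vec p, ∫ x, inner ℝ x w ^ 2 ∂ballUnif (0 : Vec p) 1 = c * ‖w‖ ^ 2)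
    (u w : Vec p) :
    ∫ x, inner ℝ x w ^ 2 ∂ballUnif u 1 = inner ℝ u w ^ 2 + c * ‖w‖ ^ 2 := by
  have := isProbabilityMeasure_ballUnif (0 : Vec p) one_pos
  have h := ballUnif_map_sub_left (0 : Vec p) u 1
  rw [sub_zero] at h
  rw [← h.integral_comp (MeasurableEquiv.subLeft u).measurableEmbedding, ← hc w]
  have h1 : ∀ x : Vec p, (inner ℝ (u - x) w : ℝ) ^ 2
      = inner ℝ u w ^ 2 - 2 * inner ℝ u w * inner ℝ x w + inner ℝ x w ^ 2 := fun x => by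
    rw [inner_sub_left]; ring
  simp_rw [h1]
  rw [integral_add, integral_sub, integral_const_mul, integral_inner_ballUnif _ _ one_pos]
  · simp
  all_goals exact integrable_ballUnif (by fun_prop) _ one_pos

/-- Jensen's inequality. In lower integrals it needs no integrability of $e^f$, since an infinite
right side is trivial. -/
lemma ofReal_exp_integral_le {S : Type*} [MeasurableSpace S] {P : Measure S}
    [IsProbabilityMeasure P] {f : S → ℝ} (hf : Integrable f P) :
    ENNReal.ofReal (Real.exp (∫ x, f x ∂P)) ≤ ∫⁻ x, ENNReal.ofReal (Real.exp (f x)) ∂P := by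
  by_cases h : ∫⁻ x, ENNReal.ofReal (Real.exp (f x)) ∂P = ∞
  · rw [h]; exact le_top
  have hi : Integrable (fun x => Real.exp (f x)) P :=
    (lintegral_ofReal_ne_top_iff_integrable
      (Real.continuous_exp.comp_aestronglyMeasurable hf.aestronglyMeasurable)
      (.of_forall fun x => (Real.exp_pos _).le)).1 h
  rw [← ofReal_integral_eq_lintegral_ofReal hi (.of_forall fun x => (Real.exp_pos _).le)]
  exact ENNReal.ofReal_le_ofReal <| convexOn_exp.map_integral_le Real.continuous_exp.continuousOn
    isClosed_univ (.of_forall fun _ => mem_univ _) hf hi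

/-- The mean of `g` over a ball. -/
def ballMean (g : Vec p → Vec p) (c : Vec p) (r : ℝ) : Vec p := ∫ x, g x ∂ballUnif c r

lemma tendsto_ballMean {g : Vec p → Vec p} (hg : Continuous g) (c : Vec p) :
    Tendsto (fun k : ℕ => ballMean g c ((1 / 2) ^ k)) atTop (𝓝 (g c)) := by
  rw [Metric.tendsto_atTop]
  intro ε hε
  obtain ⟨d, hd, hgd⟩ := Metric.continuous_iff.1 hg c (ε / 2) (by positivity)
  obtain ⟨N, hN⟩ := exists_pow_lt_of_lt_one hd (by norm_num : (1 / 2 : ℝ) < 1)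
  refine ⟨N, fun k hk => ?_⟩
  have hr : (0 : ℝ) < (1 / 2) ^ k := by positivity
  have := isProbabilityMeasure_ballUnif c hr
  have h1 : ballMean g c ((1 / 2) ^ k) - g c = ∫ x, (g x - g c) ∂ballUnif c ((1 / 2) ^ k) := by
    rw [integral_sub (integrable_ballUnif hg c hr) (integrable_const _)]
    rw [integral_const, probReal_univ, one_smul, ballMean]
  have h2 : ‖∫ x, (g x - g c) ∂ballUnif c ((1 / 2) ^ k)‖ ≤ ε / 2 := by
    have := norm_integral_le_of_norm_le_const (μ := ballUnif c ((1 / 2) ^ k)) (C := ε / 2)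
      (f := fun x => g x - g c) ?_
    · rwa [probReal_univ, mul_one] at this
    · filter_upwards [ballUnif_ae_mem c ((1 / 2) ^ k)] with x hx
      rw [← dist_eq_norm]
      refine (hgd x (lt_trans (mem_ball.1 hx) (lt_of_le_of_lt ?_ hN))).le
      exact pow_le_pow_of_le_one (by norm_num) (by norm_num) hk
  rw [dist_eq_norm, h1]
  linarith

variable {g : Vec p → Vec p} {lam T : ℝ}

/-- Jensen is applied three times: in the two endpoints, and in the direction, because $u$ is the
mean of the unit ball around it. Each of the three balls is then enlarged to the ball of radius 2 at
the price of its volume ratio, and logarithms are taken. -/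
lemma inner_ballMean_sub_le (hg : Continuous g) (hlam : 0 < lam)
    (hJ : ∫⁻ u, ∫⁻ x, ∫⁻ y, ENNReal.ofReal
        (1 + Real.exp (lam * (inner ℝ u (g x - g y) / ‖x - y‖)))
        ∂ballUnif (0 : Vec p) 2 ∂ballUnif (0 : Vec p) 2 ∂ballUnif (0 : Vec p) 2
      ≤ ENNReal.ofReal (Real.exp T))
    {a b : Vec p} {r s R : ℝ} (hr : 0 < r) (hs : 0 < s) (ha : ‖a‖ + r ≤ 2) (hb : ‖b‖ + s ≤ 2)
    (hR : ‖a - b‖ + r + s ≤ R) {u : Vec p} (hu : ‖u‖ ≤ 1) :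
    inner ℝ u (ballMean g a r - ballMean g b s) ≤
      R / lam * (T + p * Real.log 2 + p * Real.log (2 / r) + p * Real.log (2 / s)) := by
  have hR0 : 0 < R := by have := norm_nonneg (a - b); linarith
  have := isProbabilityMeasure_ballUnif a hr
  have := isProbabilityMeasure_ballUnif b hs
  have := isProbabilityMeasure_ballUnif u one_pos
  set c := lam / R with hc
  have hc0 : 0 < c := by positivity
  have e1 : ∀ u' : Vec p, c * inner ℝ u' (ballMean g a r - ballMean g b s)
      = ∫ x, c * inner ℝ u' (g x - ballMean g b s) ∂ballUnif a r := fun u' => by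
    rw [integral_const_mul, integral_inner, integral_sub, ballMean]
    · simp
    · exact integrable_ballUnif hg _ hr
    · exact integrable_const _
    · exact integrable_ballUnif (by fun_prop) _ hr
  have e2 : ∀ u' x : Vec p, c * inner ℝ u' (g x - ballMean g b s)
      = ∫ y, c * inner ℝ u' (g x - g y) ∂ballUnif b s := fun u' x => by
    rw [integral_const_mul, integral_inner, integral_sub, ballMean]
    · simp
    · exact integrable_const _
    · exact integrable_ballUnif hg _ hs
    · exact integrable_ballUnif (by fun_prop) _ hs
  have e3 : c * inner ℝ u (ballMean g a r - ballMean g b s)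
      = ∫ u', c * inner ℝ u' (ballMean g a r - ballMean g b s) ∂ballUnif u 1 := by
    rw [integral_const_mul, integral_inner_ballUnif _ _ one_pos]
  have key : ENNReal.ofReal (Real.exp (c * inner ℝ u (ballMean g a r - ballMean g b s)))
      ≤ ENNReal.ofReal ((2 / 1) ^ p) * (ENNReal.ofReal ((2 / r) ^ p) *
        (ENNReal.ofReal ((2 / s) ^ p) * ENNReal.ofReal (Real.exp T))) := by
    calc _ ≤ ∫⁻ u', ENNReal.ofReal (Real.exp
          (c * inner ℝ u' (ballMean g a r - ballMean g b s))) ∂ballUnif u 1 := by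
          rw [e3]; exact ofReal_exp_integral_le (integrable_ballUnif (by fun_prop) _ one_pos)
      _ ≤ ∫⁻ u', ∫⁻ x, ∫⁻ y, ENNReal.ofReal (Real.exp (c * inner ℝ u' (g x - g y)))
            ∂ballUnif b s ∂ballUnif a r ∂ballUnif u 1 := by
          refine lintegral_mono fun u' => ?_
          simp only
          rw [e1 u']
          refine (ofReal_exp_integral_le (integrable_ballUnif (by fun_prop) _ hr)).trans ?_
          refine lintegral_mono fun x => ?_
          simp only
          rw [e2 u' x]
          exact ofReal_exp_integral_le (integrable_ballUnif (by fun_prop) _ hs)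
      _ ≤ ∫⁻ u', ∫⁻ x, ∫⁻ y, ENNReal.ofReal
            (1 + Real.exp (lam * (inner ℝ u' (g x - g y) / ‖x - y‖)))
            ∂ballUnif b s ∂ballUnif a r ∂ballUnif u 1 := by
          refine lintegral_mono fun u' => lintegral_mono_ae ?_
          filter_upwards [ballUnif_ae_mem a r] with x hx
          refine lintegral_mono_ae ?_
          filter_upwards [ballUnif_ae_mem b s] with y hy
          refine ENNReal.ofReal_le_ofReal ?_
          rw [mem_ball_iff_norm] at hx hy
          have hxy : ‖x - y‖ ≤ R := by
            have h1 : x - y = (x - a) + (a - b) - (y - b) := by abel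
            have h2 := norm_sub_le ((x - a) + (a - b)) (y - b)
            have h3 := norm_add_le (x - a) (a - b)
            rw [h1]; linarith
          rcases eq_or_ne (x - y) 0 with h0 | h0
          · rw [sub_eq_zero] at h0
            simp [h0]
          · have hpos : 0 < ‖x - y‖ := norm_pos_iff.2 h0
            set i : ℝ := inner ℝ u' (g x - g y)
            -- Passing from $1/R$ to $1/\|x-y\|$ increases the exponent only when it is nonnegative;
            -- otherwise the exponential is at most the added 1.
            rcases le_total i 0 with hi | hi
            · have : Real.exp (c * i) ≤ 1 :=
                Real.exp_le_one_iff.2 (mul_nonpos_of_nonneg_of_nonpos hc0.le hi)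
              have := Real.exp_pos (lam * (i / ‖x - y‖))
              linarith
            · have : Real.exp (c * i) ≤ Real.exp (lam * (i / ‖x - y‖)) := by
                rw [Real.exp_le_exp, hc, div_mul_eq_mul_div, ← mul_div_assoc]
                gcongr
              linarith
      _ ≤ _ := by
          refine (lintegral_ballUnif_le u one_pos (by linarith) _).trans ?_
          gcongr
          refine le_trans (b := ∫⁻ u', ENNReal.ofReal ((2 / r) ^ p) * (∫⁻ x,
            ENNReal.ofReal ((2 / s) ^ p) * ∫⁻ y, ENNReal.ofReal
            (1 + Real.exp (lam * (inner ℝ u' (g x - g y) / ‖x - y‖)))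
            ∂ballUnif (0 : Vec p) 2 ∂ballUnif (0 : Vec p) 2) ∂ballUnif (0 : Vec p) 2) ?_ ?_
          · refine lintegral_mono fun u' => ?_
            refine (lintegral_ballUnif_le a hr ha _).trans ?_
            gcongr with x
            exact lintegral_ballUnif_le b hs hb _
          · rw [lintegral_const_mul' _ _ ENNReal.ofReal_ne_top]
            gcongr
            simp_rw [lintegral_const_mul' _ _ (ENNReal.ofReal_ne_top (r := (2 / s) ^ p))]
            gcongr
  rw [← ENNReal.ofReal_mul (by positivity), ← ENNReal.ofReal_mul (by positivity),
    ← ENNReal.ofReal_mul (by positivity), ENNReal.ofReal_le_ofReal_iff (by positivity)] at key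
  have h1 := Real.log_le_log (Real.exp_pos _) key
  rw [Real.log_exp, Real.log_mul (by positivity) (by positivity),
    Real.log_mul (by positivity) (by positivity), Real.log_mul (by positivity) (by positivity),
    Real.log_exp, Real.log_pow, Real.log_pow, Real.log_pow, div_one] at h1
  have h2 : inner ℝ u (ballMean g a r - ballMean g b s)
      = R / lam * (c * inner ℝ u (ballMean g a r - ballMean g b s)) := by
    rw [hc]; field_simp
  rw [h2]
  gcongr
  linarith

/-- Sums the chaining increments: $\sum_k2\cdot2^{-k}=4$ and $\sum_k2\cdot2^{-k}(2k+4)=24$. The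
induction carries the exact partial sums. -/
lemma sub_le_of_forall_succ_sub_le (hlam : 0 < lam) {q : ℝ} (hq : 0 ≤ q)
    (hT : 0 ≤ T) (F : ℕ → ℝ)
    (h : ∀ k, F (k + 1) - F k ≤ 2 * (1 / 2) ^ k / lam * (T + (2 * k + 4) * q)) (N : ℕ) :
    F N - F 0 ≤ (4 * T + 24 * q) / lam := by
  have key : ∀ N : ℕ, F N - F 0 ≤
      (4 * T + 24 * q - (1 / 2) ^ N * (4 * T + (8 * N + 24) * q)) / lam := by
    intro N
    induction N with
    | zero => simp
    | succ k ih =>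
      have h1 := h k
      have : (4 * T + 24 * q - (1 / 2) ^ (k + 1) * (4 * T + (8 * (k + 1 : ℕ) + 24) * q)) / lam
        = (4 * T + 24 * q - (1 / 2) ^ k * (4 * T + (8 * k + 24) * q)) / lam
          + 2 * (1 / 2) ^ k / lam * (T + (2 * k + 4) * q) := by
        push_cast
        field_simp
        ring
      linarith
  refine (key N).trans ?_
  gcongr
  have : (0 : ℝ) ≤ (1 / 2) ^ N * (4 * T + (8 * N + 24) * q) := by positivity
  linarith

/-- A chaining bound: control of an exponential integral of the increments of `g` over the ball of
radius `2` bounds the increments of `g` on the unit ball. -/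
theorem norm_sub_le_of_lintegral_exp (hg : Continuous g) (hlam : 0 < lam) (hT : 0 ≤ T)
    (hJ : ∫⁻ u, ∫⁻ x, ∫⁻ y, ENNReal.ofReal
        (1 + Real.exp (lam * (inner ℝ u (g x - g y) / ‖x - y‖)))
        ∂ballUnif (0 : Vec p) 2 ∂ballUnif (0 : Vec p) 2 ∂ballUnif (0 : Vec p) 2
      ≤ ENNReal.ofReal (Real.exp T))
    {v : Vec p} (hv : ‖v‖ ≤ 1) :
    ‖g v - g 0‖ ≤ (11 * T + 57 * p) / lam := by
  set q := p * Real.log 2 with hq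
  have hlog : 0 < Real.log 2 := Real.log_pos one_lt_two
  have hlog1 : Real.log 2 ≤ 1 := by
    have := Real.log_le_sub_one_of_pos (two_pos : (0 : ℝ) < 2); linarith
  have hq0 : 0 ≤ q := by positivity
  have hqp : q ≤ p := by rw [hq]; exact mul_le_of_le_one_right (by positivity) hlog1
  have hl : ∀ k : ℕ, Real.log (2 / (1 / 2) ^ k) = (k + 1) * Real.log 2 := fun k => by
    have : (2 : ℝ) / (1 / 2) ^ k = 2 ^ (k + 1) := by
      rw [one_div, inv_pow, div_inv_eq_mul, pow_succ]; ring
    rw [this, Real.log_pow]; push_cast; ring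
  have hk1 : ∀ k : ℕ, (1 / 2 : ℝ) ^ k ≤ 1 := fun k => pow_le_one₀ (by norm_num) (by norm_num)
  -- Points of concentric balls of radii $2^{-k}$ and $2^{-k-1}$ are within $\tfrac32 2^{-k}\le R$.
  -- The volume logarithms are $1$, $k+1$ and $k+2$ times $q$, in total $(2k+4)q$.
  have step : ∀ (w : Vec p), ‖w‖ ≤ 1 → ∀ u : Vec p, ‖u‖ ≤ 1 → ∀ k : ℕ,
      inner ℝ u (ballMean g w ((1 / 2) ^ (k + 1)) - ballMean g w ((1 / 2) ^ k)) ≤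
        2 * (1 / 2) ^ k / lam * (T + (2 * k + 4) * q) ∧
      inner ℝ u (ballMean g w ((1 / 2) ^ k) - ballMean g w ((1 / 2) ^ (k + 1))) ≤
        2 * (1 / 2) ^ k / lam * (T + (2 * k + 4) * q) := by
    intro w hw u hu k
    have h2 : (1 / 2 : ℝ) ^ (k + 1) ≤ (1 / 2) ^ k := by
      rw [pow_succ]; have : (0 : ℝ) < (1 / 2) ^ k := by positivity
      linarith
    constructor
    · refine (inner_ballMean_sub_le hg hlam hJ (R := 2 * (1 / 2) ^ k) (by positivity)
        (by positivity) (by linarith [hk1 (k + 1)]) (by linarith [hk1 k])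
        (by rw [sub_self, norm_zero]; linarith)
        hu).trans_eq ?_
      rw [hl, hl, hq]; push_cast; ring
    · refine (inner_ballMean_sub_le hg hlam hJ (R := 2 * (1 / 2) ^ k) (by positivity)
        (by positivity) (by linarith [hk1 k]) (by linarith [hk1 (k + 1)])
        (by rw [sub_self, norm_zero]; linarith)
        hu).trans_eq ?_
      rw [hl, hl, hq]; push_cast; ring
  have lim : ∀ u w : Vec p, Tendsto (fun k : ℕ => inner ℝ u (ballMean g w ((1 / 2) ^ k)))
      atTop (𝓝 (inner ℝ u (g w))) := fun u w =>
    tendsto_const_nhds.inner (tendsto_ballMean hg w)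
  have main : ∀ u : Vec p, ‖u‖ ≤ 1 → inner ℝ u (g v - g 0) ≤ (11 * T + 57 * q) / lam := by
    intro u hu
    have h1 : inner ℝ u (g v) - inner ℝ u (ballMean g v 1) ≤ (4 * T + 24 * q) / lam := by
      refine le_of_tendsto ((lim u v).sub_const _) (.of_forall fun N => ?_)
      have := sub_le_of_forall_succ_sub_le hlam hq0 hT
        (fun k => inner ℝ u (ballMean g v ((1 / 2) ^ k)))
        (fun k => by rw [← inner_sub_right]; exact (step v hv u hu k).1) N
      simpa using this
    have h2 : inner ℝ u (ballMean g 0 1) - inner ℝ u (g 0) ≤ (4 * T + 24 * q) / lam := by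
      refine le_of_tendsto ((lim u 0).const_sub _) (.of_forall fun N => ?_)
      have := sub_le_of_forall_succ_sub_le hlam hq0 hT
        (fun k => - inner ℝ u (ballMean g 0 ((1 / 2) ^ k)))
        (fun k => by
          rw [neg_sub_neg, ← inner_sub_right]
          exact (step 0 (by simp) u hu k).2) N
      have e : (1 / 2 : ℝ) ^ 0 = 1 := pow_zero _
      rw [e] at this
      linarith
    have h3 : inner ℝ u (ballMean g v 1 - ballMean g 0 1) ≤ 3 / lam * (T + 3 * q) := by
      refine (inner_ballMean_sub_le hg hlam hJ (R := 3) one_pos one_pos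
        (by linarith) (by simp) (by simp; linarith) hu).trans_eq ?_
      rw [div_one, hq]; ring
    rw [inner_sub_right] at h3 ⊢
    -- Two chains, at $v$ and at $0$, and one link between their unit balls: $11=4+4+3$ and
    -- $57=24+24+9$.
    have : (11 * T + 57 * q) / lam = (4 * T + 24 * q) / lam + (4 * T + 24 * q) / lam
        + 3 / lam * (T + 3 * q) := by field_simp; ring
    linarith
  have hfin : (11 * T + 57 * q) / lam ≤ (11 * T + 57 * p) / lam := by gcongr
  refine le_trans ?_ hfin
  rcases eq_or_ne (g v - g 0) 0 with h0 | h0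
  · rw [h0, norm_zero]; positivity
  · have h := main (‖g v - g 0‖⁻¹ • (g v - g 0))
      (by rw [norm_smul, norm_inv, norm_norm, inv_mul_cancel₀ (norm_ne_zero_iff.2 h0)])
    rwa [real_inner_smul_left, real_inner_self_eq_norm_sq, sq, ← mul_assoc,
      inv_mul_cancel₀ (norm_ne_zero_iff.2 h0), one_mul] at h

end BallMeasure

/-! ### Markov, Bernstein and second moment bounds. -/

section Concentration

open Metric Filter Topology
open scoped ENNReal

variable {S : Type*} [MeasurableSpace S] {P : Measure S}

/-- Markov's inequality. The case $a=0$ is separate because the threshold is then zero; it does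
occur, for instance when $\bar\sigma=0$. -/
lemma meas_lt_le_of_lintegral_le {Q : Measure S} {f : S → ℝ≥0∞} (hf : Measurable f) {a δ : ℝ}
    (hδ : 0 < δ) (ha : 0 ≤ a) (h : ∫⁻ s, f s ∂Q ≤ ENNReal.ofReal a) :
    Q {s | ENNReal.ofReal (a / δ) < f s} ≤ ENNReal.ofReal δ := by
  rcases ha.eq_or_lt with rfl | ha
  · have h0 : f =ᵐ[Q] 0 := (lintegral_eq_zero_iff hf).1 (by simpa using h)
    have : Q {s | ENNReal.ofReal (0 / δ) < f s} = 0 := by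
      refine measure_mono_null ?_ (ae_iff.1 h0)
      intro s hs
      simp only [zero_div, ENNReal.ofReal_zero, mem_ofPred_eq, Pi.zero_apply] at hs ⊢
      exact hs.ne'
    rw [this]
    exact zero_le
  · have hpos : 0 < a / δ := by positivity
    calc Q {s | ENNReal.ofReal (a / δ) < f s} ≤ Q {s | ENNReal.ofReal (a / δ) ≤ f s} :=
          by
          refine measure_mono fun s hs => ?_
          rw [mem_ofPred_eq] at hs ⊢
          exact hs.le
      _ ≤ (∫⁻ s, f s ∂Q) / ENNReal.ofReal (a / δ) :=
          meas_ge_le_lintegral_div hf.aemeasurable (by simpa using hpos) ENNReal.ofReal_ne_top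
      _ ≤ ENNReal.ofReal a / ENNReal.ofReal (a / δ) := by gcongr
      _ = ENNReal.ofReal δ := by
          rw [← ENNReal.ofReal_div_of_pos hpos]
          congr 1
          field_simp

/-- Only an upper bound on $x$ is needed, which is what lets the lower tail dispense with
exponential moments. -/
lemma exp_le_one_add_add_sq {x : ℝ} (hx : x ≤ 1) : Real.exp x ≤ 1 + x + x ^ 2 := by
  rcases le_total (-1) x with h | h
  · have := (abs_le.1 (Real.abs_exp_sub_one_sub_id_le (abs_le.2 ⟨h, hx⟩))).2
    linarith
  · have : Real.exp x ≤ 1 := Real.exp_le_one_iff.2 (by linarith)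
    nlinarith

lemma exp_le_one_add_add_sq_mul (x : ℝ) :
    Real.exp x ≤ 1 + x + x ^ 2 * Real.exp |x| := by
  have h := Complex.norm_exp_sub_sum_le_norm_mul_exp (x : ℂ) 2
  have e : Complex.exp x - ∑ m ∈ Finset.range 2, (x : ℂ) ^ m / m.factorial
      = ((Real.exp x - (1 + x) : ℝ) : ℂ) := by
    simp [Finset.sum_range_succ]
  rw [e, Complex.norm_real, Complex.norm_real, Real.norm_eq_abs, Real.norm_eq_abs, sq_abs] at h
  linarith [le_abs_self (Real.exp x - (1 + x))]

/-- Bernstein's bound for a sub-exponential variable: expand $e^{\eta\xi}$ to second order, absorb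
the remainder into $e^{|\xi|/K}$, and use $1+x\le e^x$ to restore an exponential. -/
lemma lintegral_exp_centered_le [IsProbabilityMeasure P] {ξ : S → ℝ} (hξ : Measurable ξ)
    {K η : ℝ} (hK : 0 < K) (hη : 0 ≤ η) (hηK : 2 * (η * K) ≤ 1)
    (h : ∫⁻ s, ENNReal.ofReal (Real.exp (|ξ s| / K)) ∂P ≤ ENNReal.ofReal 3) :
    ∫⁻ s, ENNReal.ofReal (Real.exp (η * (ξ s - ∫ s, ξ s ∂P))) ∂P
      ≤ ENNReal.ofReal (Real.exp (24 * (η * K) ^ 2)) := by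
  have hE : Integrable (fun s => Real.exp (|ξ s| / K)) P :=
    (lintegral_ofReal_ne_top_iff_integrable (by fun_prop)
      (.of_forall fun x => (Real.exp_pos _).le)).1 (h.trans_lt ENNReal.ofReal_lt_top).ne
  have hE3 : ∫ s, Real.exp (|ξ s| / K) ∂P ≤ 3 := by
    rwa [← ofReal_integral_eq_lintegral_ofReal hE (.of_forall fun x => (Real.exp_pos _).le),
      ENNReal.ofReal_le_ofReal_iff (by norm_num)] at h
  have hξi : Integrable ξ P := by
    refine (hE.const_mul K).mono' hξ.aestronglyMeasurable (.of_forall fun s => ?_)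
    have := Real.add_one_le_exp (|ξ s| / K)
    have h1 : |ξ s| = K * (|ξ s| / K) := by field_simp
    rw [Real.norm_eq_abs]
    nlinarith
  set m := ∫ s, ξ s ∂P with hm
  have hpt : ∀ s, Real.exp (η * ξ s) ≤
      1 + η * ξ s + 8 * (η * K) ^ 2 * Real.exp (|ξ s| / K) := fun s => by
    refine (exp_le_one_add_add_sq_mul _).trans ?_
    set y := |ξ s| / K with hy
    have hy0 : 0 ≤ y := by positivity
    have h1 : |η * ξ s| ≤ y / 2 := by
      rw [abs_mul, abs_of_nonneg hη, hy]
      have : η * |ξ s| = (η * K) * (|ξ s| / K) := by field_simp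
      rw [this]
      nlinarith
    have h2 : (η * ξ s) ^ 2 = (η * K) ^ 2 * y ^ 2 := by
      rw [hy, ← sq_abs, abs_mul, abs_of_nonneg hη]; field_simp
    -- From $x^2/2\le e^x$ at $x=y/2$. This 8 times the moment bound 3 is the 24 of the conclusion.
    have h3 : y ^ 2 ≤ 8 * Real.exp (y / 2) := by
      have := Real.quadratic_le_exp_of_nonneg (x := y / 2) (by positivity)
      nlinarith
    have h4 : Real.exp y = Real.exp (y / 2) * Real.exp (y / 2) := by
      rw [← Real.exp_add]; ring_nf
    have h5 : Real.exp |η * ξ s| ≤ Real.exp (y / 2) := Real.exp_le_exp.2 h1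
    have h6 : y ^ 2 * Real.exp |η * ξ s| ≤ 8 * Real.exp (y / 2) * Real.exp (y / 2) := by gcongr
    rw [h2, h4]
    have := mul_le_mul_of_nonneg_left h6 (sq_nonneg (η * K))
    linarith
  have hint : Integrable
      (fun s => 1 + η * ξ s + 8 * (η * K) ^ 2 * Real.exp (|ξ s| / K)) P :=
    ((integrable_const _).add (hξi.const_mul _)).add (hE.const_mul _)
  have hexp : Integrable (fun s => Real.exp (η * ξ s)) P :=
    hint.mono' (by fun_prop) (.of_forall fun s => by
      rw [Real.norm_eq_abs, abs_of_pos (Real.exp_pos _)]; exact hpt s)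
  have hbound : ∫ s, Real.exp (η * ξ s) ∂P ≤ Real.exp (24 * (η * K) ^ 2 + η * m) := by
    refine (integral_mono hexp hint hpt).trans ?_
    have h3 : Integrable (fun s => 1 + η * ξ s) P := (integrable_const _).add (hξi.const_mul _)
    rw [integral_add h3 (hE.const_mul _),
      integral_add (integrable_const _) (hξi.const_mul _), integral_const_mul,
      integral_const_mul]
    simp only [integral_const, probReal_univ, one_smul]
    have h1 := Real.add_one_le_exp (24 * (η * K) ^ 2 + η * m)
    have h2 := mul_le_mul_of_nonneg_left hE3 (by positivity : 0 ≤ 8 * (η * K) ^ 2)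
    linarith
  have hsplit : ∀ s, Real.exp (η * (ξ s - m)) = Real.exp (-(η * m)) * Real.exp (η * ξ s) :=
    fun s => by rw [← Real.exp_add]; ring_nf
  simp_rw [hsplit]
  rw [← ofReal_integral_eq_lintegral_ofReal (hexp.const_mul _)
    (.of_forall fun x => by positivity), integral_const_mul]
  refine ENNReal.ofReal_le_ofReal ?_
  calc _ ≤ Real.exp (-(η * m)) * Real.exp (24 * (η * K) ^ 2 + η * m) := by gcongr
    _ = _ := by rw [← Real.exp_add]; ring_nf

lemma lintegral_pi_exp_sum_le [IsProbabilityMeasure P] {n : ℕ} {f : S → ℝ} (hf : Measurable f)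
    {a : ℝ} (h : ∫⁻ s, ENNReal.ofReal (Real.exp (f s)) ∂P ≤ ENNReal.ofReal (Real.exp a)) :
    ∫⁻ z, ENNReal.ofReal (Real.exp (∑ i, f (z i))) ∂(Measure.pi fun _ : Fin n => P)
      ≤ ENNReal.ofReal (Real.exp (n * a)) := by
  have hind : iIndepFun (fun (i : Fin n) (z : Fin n → S) => ENNReal.ofReal (Real.exp (f (z i))))
      (Measure.pi fun _ : Fin n => P) :=
    iIndepFun_pi (X := fun _ s => ENNReal.ofReal (Real.exp (f s))) fun _ =>
      (hf.exp.ennreal_ofReal).aemeasurable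
  have h1 : ∀ z : Fin n → S, ENNReal.ofReal (Real.exp (∑ i, f (z i)))
      = ∏ i, ENNReal.ofReal (Real.exp (f (z i))) := fun z => by
    rw [Real.exp_sum, ENNReal.ofReal_prod_of_nonneg fun _ _ => (Real.exp_pos _).le]
  simp_rw [h1]
  rw [lintegral_prod_eq_prod_lintegral_of_indepFun Finset.univ _ hind
    fun i => (hf.comp (measurable_pi_apply i)).exp.ennreal_ofReal]
  have h2 : ∀ i : Fin n, ∫⁻ z, ENNReal.ofReal (Real.exp (f (z i)))
      ∂(Measure.pi fun _ : Fin n => P) = ∫⁻ s, ENNReal.ofReal (Real.exp (f s)) ∂P := fun i =>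
    (measurePreserving_eval (fun _ : Fin n => P) i).lintegral_comp
      (f := fun s => ENNReal.ofReal (Real.exp (f s))) (by fun_prop)
  simp_rw [h2]
  rw [Finset.prod_const, Finset.card_univ, Fintype.card_fin, Real.exp_nat_mul,
    ENNReal.ofReal_pow (Real.exp_pos _).le]
  gcongr

variable {p n : ℕ}

/-- A second moment bound for the norm of a sum of independent centered random vectors. -/
theorem exists_norm_sum_sq_le [IsProbabilityMeasure P] {ζ : S → Vec p} (hζ : Measurable ζ)
    (h2 : MemLp ζ 2 P) (h0 : ∫ s, ζ s ∂P = 0) {V : ℝ} (hV : 0 ≤ V)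
    (hζV : ∫ s, ‖ζ s‖ ^ 2 ∂P ≤ V) {δ : ℝ} (hδ : 0 < δ) (n : ℕ) :
    ∃ B : Set (Fin n → S), MeasurableSet B ∧
      Measure.pi (fun _ : Fin n => P) B ≤ ENNReal.ofReal δ ∧
      ∀ z ∉ B, ‖∑ i, ζ (z i)‖ ^ 2 ≤ n * V / δ := by
  set Q := Measure.pi (fun _ : Fin n => P)
  have hmeas : Measurable fun z : Fin n → S => ENNReal.ofReal (‖∑ i, ζ (z i)‖ ^ 2) := by fun_prop
  have hcoord : ∀ j, MemLp (fun s => ζ s j) 2 P := fun j =>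
    h2.mono (by fun_prop) (.of_forall fun s => by
      simpa using PiLp.norm_apply_le (ζ s) j)
  -- In each coordinate the variances of independent copies add, and centring turns variances into
  -- second moments.
  have hvar : ∀ j : Fin p, ∫ z, (∑ i, ζ (z i) j) ^ 2 ∂Q = n * ∫ s, ζ s j ^ 2 ∂P := fun j => by
    have hmean : ∫ s, ζ s j ∂P = 0 := by
      have := (EuclideanSpace.proj (𝕜 := ℝ) j).integral_comp_comm (h2.integrable one_le_two)
      simpa [h0] using this
    have hv := variance_sum_pi (ι := Fin n) (μ := fun _ => P) (X := fun _ s => ζ s j)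
      fun _ => hcoord j
    have hm2 : ∀ i : Fin n, MemLp (fun z : Fin n → S => ζ (z i) j) 2 Q := fun i =>
      (hcoord j).comp_measurePreserving (measurePreserving_eval (fun _ : Fin n => P) i)
    have hmi : ∀ i : Fin n, ∫ z, ζ (z i) j ∂Q = 0 := fun i => by
      rw [← hmean]
      have hmp := measurePreserving_eval (fun _ : Fin n => P) i
      rw [← hmp.map_eq, integral_map hmp.measurable.aemeasurable (by fun_prop)]
    rw [variance_of_integral_eq_zero, Finset.sum_const, Finset.card_univ, Fintype.card_fin,
      variance_of_integral_eq_zero (by fun_prop) hmean] at hv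
    · simpa using hv
    · fun_prop
    · simp only [Finset.sum_apply]
      rw [integral_finsetSum _ fun i _ => (hm2 i).integrable one_le_two]
      exact Finset.sum_eq_zero fun i _ => hmi i
  have hsum2 : ∀ j : Fin p, Integrable (fun z : Fin n → S => (∑ i, ζ (z i) j) ^ 2) Q := fun j => by
    have : MemLp (fun z : Fin n → S => ∑ i, ζ (z i) j) 2 Q :=
      memLp_finsetSum _ fun i _ =>
        (hcoord j).comp_measurePreserving (measurePreserving_eval (fun _ : Fin n => P) i)
    exact this.integrable_sq
  have hn : ∀ z : Fin n → S, ‖∑ i, ζ (z i)‖ ^ 2 = ∑ j, (∑ i, ζ (z i) j) ^ 2 := fun z => by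
    rw [EuclideanSpace.real_norm_sq_eq]
    simp
  have htot : ∫ z, ‖∑ i, ζ (z i)‖ ^ 2 ∂Q ≤ n * V := by
    simp_rw [hn]
    rw [integral_finsetSum _ fun j _ => hsum2 j]
    simp_rw [hvar]
    rw [← Finset.mul_sum, ← integral_finsetSum _ fun j _ => (hcoord j).integrable_sq]
    simp_rw [← EuclideanSpace.real_norm_sq_eq]
    gcongr
  refine ⟨_, measurableSet_lt measurable_const hmeas,
    meas_lt_le_of_lintegral_le hmeas hδ (a := n * V) (by positivity) ?_, ?_⟩
  · rw [← ofReal_integral_eq_lintegral_ofReal _ (.of_forall fun z => by positivity)]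
    · exact ENNReal.ofReal_le_ofReal htot
    · simp_rw [hn]
      exact integrable_finsetSum _ fun j _ => hsum2 j
  · intro z hz
    simp only [mem_ofPred_eq, not_lt] at hz
    exact (ENNReal.ofReal_le_ofReal_iff (by positivity)).1 hz

section Moments

variable {W : S → Vec p} {k : ℝ}

lemma integrable_inner_pow_four (hW : Measurable W) (hi : Integrable (fun s => ‖W s‖ ^ 4) P)
    (u : Vec p) : Integrable (fun s => inner ℝ u (W s) ^ 4) P := by
  refine (hi.const_mul (‖u‖ ^ 4)).mono' (by fun_prop) (.of_forall fun s => ?_)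
  rw [norm_pow, ← mul_pow]
  gcongr
  exact norm_inner_le_norm _ _

lemma norm_sq_eq_sum_inner (w : Vec p) :
    ‖w‖ ^ 2 = ∑ j, inner ℝ (EuclideanSpace.single j (1 : ℝ)) w ^ 2 := by
  rw [EuclideanSpace.real_norm_sq_eq]
  simp [EuclideanSpace.inner_single_left]

lemma integrable_inner_sq_mul_inner_sq (hW : Measurable W)
    (hi : Integrable (fun s => ‖W s‖ ^ 4) P) (u v : Vec p) :
    Integrable (fun s => inner ℝ u (W s) ^ 2 * inner ℝ v (W s) ^ 2) P := by
  refine ((integrable_inner_pow_four hW hi u).add (integrable_inner_pow_four hW hi v)).mono'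
    (by fun_prop) (.of_forall fun s => ?_)
  rw [Real.norm_eq_abs, abs_of_nonneg (by positivity)]
  simp only [Pi.add_apply]
  nlinarith [sq_nonneg ((inner ℝ u (W s) : ℝ) ^ 2 - inner ℝ v (W s) ^ 2),
    sq_nonneg ((inner ℝ u (W s) : ℝ) ^ 2), sq_nonneg ((inner ℝ v (W s) : ℝ) ^ 2)]

lemma integral_inner_sq_mul_inner_sq_le (hW : Measurable W)
    (hi : Integrable (fun s => ‖W s‖ ^ 4) P)
    (h4 : ∀ u : Vec p, ∫ s, inner ℝ u (W s) ^ 4 ∂P ≤ k * ‖u‖ ^ 4) {u v : Vec p}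
    (hu : ‖u‖ = 1) (hv : ‖v‖ = 1) :
    ∫ s, inner ℝ u (W s) ^ 2 * inner ℝ v (W s) ^ 2 ∂P ≤ k := by
  have h1 : ∫ s, inner ℝ u (W s) ^ 2 * inner ℝ v (W s) ^ 2 ∂P ≤
      ∫ s, (1 / 2 * inner ℝ u (W s) ^ 4 + 1 / 2 * inner ℝ v (W s) ^ 4) ∂P := by
    refine integral_mono (integrable_inner_sq_mul_inner_sq hW hi u v)
      (((integrable_inner_pow_four hW hi u).const_mul _).add
        ((integrable_inner_pow_four hW hi v).const_mul _)) fun s => ?_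
    simp only
    nlinarith [sq_nonneg ((inner ℝ u (W s) : ℝ) ^ 2 - inner ℝ v (W s) ^ 2)]
  rw [integral_add ((integrable_inner_pow_four hW hi u).const_mul _)
    ((integrable_inner_pow_four hW hi v).const_mul _), integral_const_mul,
    integral_const_mul] at h1
  have h2 := h4 u
  have h3 := h4 v
  rw [hu] at h2
  rw [hv] at h3
  linarith

/-- Expand $\|W\|^2$ in an orthonormal basis; each of the $p$ mixed moments is at most $k$. A second
expansion gives `integral_norm_pow_four_le`. -/
lemma integral_inner_sq_mul_norm_sq_le (hW : Measurable W)
    (hi : Integrable (fun s => ‖W s‖ ^ 4) P)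
    (h4 : ∀ u : Vec p, ∫ s, inner ℝ u (W s) ^ 4 ∂P ≤ k * ‖u‖ ^ 4) {u : Vec p}
    (hu : ‖u‖ = 1) :
    Integrable (fun s => inner ℝ u (W s) ^ 2 * ‖W s‖ ^ 2) P ∧
    ∫ s, inner ℝ u (W s) ^ 2 * ‖W s‖ ^ 2 ∂P ≤ p * k := by
  simp_rw [norm_sq_eq_sum_inner (W _), Finset.mul_sum]
  refine ⟨integrable_finsetSum _ fun j _ => integrable_inner_sq_mul_inner_sq hW hi _ _, ?_⟩
  rw [integral_finsetSum _ fun j _ => integrable_inner_sq_mul_inner_sq hW hi _ _]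
  calc _ ≤ ∑ j : Fin p, k := Finset.sum_le_sum fun j _ =>
        integral_inner_sq_mul_inner_sq_le hW hi h4 hu (by simp)
    _ = p * k := by simp

lemma integral_norm_pow_four_le (hW : Measurable W) (hi : Integrable (fun s => ‖W s‖ ^ 4) P)
    (h4 : ∀ u : Vec p, ∫ s, inner ℝ u (W s) ^ 4 ∂P ≤ k * ‖u‖ ^ 4) :
    ∫ s, ‖W s‖ ^ 4 ∂P ≤ p ^ 2 * k := by
  have h : ∀ s, ‖W s‖ ^ 4
      = ∑ j, inner ℝ (EuclideanSpace.single j (1 : ℝ)) (W s) ^ 2 * ‖W s‖ ^ 2 := fun s => by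
    rw [← Finset.sum_mul, ← norm_sq_eq_sum_inner]; ring
  simp_rw [h]
  rw [integral_finsetSum _ fun j _ => (integral_inner_sq_mul_norm_sq_le hW hi h4 (by simp)).1]
  calc _ ≤ ∑ j : Fin p, p * k := Finset.sum_le_sum fun j _ =>
        (integral_inner_sq_mul_norm_sq_le hW hi h4 (by simp)).2
    _ = p ^ 2 * k := by simp; ring

end Moments

end Concentration

/-! ### Pointwise properties of the two kinds of summands. -/

section Summands

variable {S : Type*} {p : ℕ} {W : S → Vec p} {φ : S → ℝ → ℝ}

/-- The summand of the exponent in the PAC-Bayes argument for the smallest eigenvalue. -/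
def truncQuad (W : S → Vec p) (ξ c h : ℝ) (s : S) (θ : Vec p) : ℝ :=
  {s | ‖W s‖ ^ 2 ≤ h}.indicator (fun s => ξ * (c * ‖W s‖ ^ 2 - inner ℝ θ (W s) ^ 2)) s

lemma abs_truncQuad_le {ξ c : ℝ} (hξ : 0 ≤ ξ) (hc : 0 ≤ c) (h : ℝ) (s : S) (θ : Vec p) :
    |truncQuad W ξ c h s θ| ≤ ξ * (c + ‖θ‖ ^ 2) * ‖W s‖ ^ 2 := by
  have hi : inner ℝ θ (W s) ^ 2 ≤ ‖θ‖ ^ 2 * ‖W s‖ ^ 2 := by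
    rw [← mul_pow, ← sq_abs]
    gcongr
    exact abs_real_inner_le_norm _ _
  rw [truncQuad]
  by_cases hs : s ∈ {s | ‖W s‖ ^ 2 ≤ h}
  · rw [indicator_of_mem hs, abs_mul, abs_of_nonneg hξ, mul_assoc]
    gcongr
    have h1 : 0 ≤ c * ‖W s‖ ^ 2 := by positivity
    have h2 : 0 ≤ (inner ℝ θ (W s) : ℝ) ^ 2 := sq_nonneg _
    rw [abs_le]
    constructor <;> linarith
  · rw [indicator_of_notMem hs, abs_zero]
    positivity

/-- The term $c\|W\|^2$ in `truncQuad` is exactly what smoothing over the unit ball adds to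
$(u^TW)^2$, so averaging leaves the quadratic form at $u$. -/
lemma integral_truncQuad_ballUnif {ξ c h : ℝ}
    (hc : ∀ w : Vec p, ∫ x, inner ℝ x w ^ 2 ∂ballUnif (0 : Vec p) 1 = c * ‖w‖ ^ 2)
    (u : Vec p) (s : S) :
    ∫ θ, truncQuad W ξ c h s θ ∂ballUnif u 1
      = {s | ‖W s‖ ^ 2 ≤ h}.indicator (fun s => -(ξ * inner ℝ u (W s) ^ 2)) s := by
  have := isProbabilityMeasure_ballUnif u one_pos
  simp only [truncQuad]
  by_cases hs : s ∈ {s | ‖W s‖ ^ 2 ≤ h}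
  · simp only [indicator_of_mem hs]
    rw [integral_const_mul, integral_sub (integrable_const _)
      (integrable_ballUnif (by fun_prop) _ one_pos), integral_inner_sq_ballUnif hc]
    simp
  · simp only [indicator_of_notMem hs, integral_zero]

/-- The summand of a multiplier empirical process. -/
def multSummand (W : S → Vec p) (φ : S → ℝ → ℝ) (s : S) (v : Vec p) : Vec p :=
  φ s (inner ℝ v (W s)) • W s

lemma abs_inner_multSummand_sub_le (hl : ∀ s a b, |φ s a - φ s b| ≤ |a - b|) (s : S)
    (u x y : Vec p) :
    |inner ℝ u (multSummand W φ s x - multSummand W φ s y)| ≤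
      |inner ℝ u (W s)| * |inner ℝ (x - y) (W s)| := by
  rw [multSummand, multSummand, ← sub_smul, real_inner_smul_right, abs_mul, mul_comm,
    inner_sub_left]
  exact mul_le_mul_of_nonneg_left (hl _ _ _) (abs_nonneg _)

lemma norm_multSummand_sub_le (hl : ∀ s a b, |φ s a - φ s b| ≤ |a - b|) (s : S) (x y : Vec p) :
    ‖multSummand W φ s x - multSummand W φ s y‖ ≤ ‖x - y‖ * ‖W s‖ ^ 2 := by
  rw [multSummand, multSummand, ← sub_smul, norm_smul, Real.norm_eq_abs, sq, ← mul_assoc]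
  gcongr
  refine (hl _ _ _).trans ?_
  rw [← inner_sub_left]
  exact abs_real_inner_le_norm _ _

end Summands

/-! ### Uniform bounds for empirical processes. -/

section EmpiricalProcess

open Metric Filter Topology
open scoped ENNReal

variable {S : Type*} [MeasurableSpace S] {P : Measure S} {p n : ℕ} {W : S → Vec p}

lemma measurable_comp₂ {α β γ X : Type*} [MeasurableSpace α] [MeasurableSpace β]
    [MeasurableSpace γ] [MeasurableSpace X] {f : α → β → γ}
    (hf : Measurable fun q : α × β => f q.1 q.2) {a : X → α} {b : X → β} (ha : Measurable a)
    (hb : Measurable b) : Measurable fun x => f (a x) (b x) :=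
  Measurable.comp (g := fun q : α × β => f q.1 q.2) hf (ha.prodMk hb)

/-! ### Smallest eigenvalue of the empirical second moment matrix. -/

section LowerTail

lemma measurable_truncQuad (hW : Measurable W) (ξ c h : ℝ) :
    Measurable fun q : S × Vec p => truncQuad W ξ c h q.1 q.2 := by
  have : (fun q : S × Vec p => truncQuad W ξ c h q.1 q.2) =
      {q : S × Vec p | ‖W q.1‖ ^ 2 ≤ h}.indicator
        (fun q => ξ * (c * ‖W q.1‖ ^ 2 - inner ℝ q.2 (W q.1) ^ 2)) := by
    ext q; rfl
  rw [this]
  exact Measurable.indicator (by fun_prop) (measurableSet_le (by fun_prop) (by fun_prop))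

lemma integrable_norm_sq_of_pow_four [IsFiniteMeasure P] (hW : Measurable W)
    (hi : Integrable (fun s => ‖W s‖ ^ 4) P) : Integrable (fun s => ‖W s‖ ^ 2) P := by
  refine ((integrable_const (1 : ℝ)).add hi).mono' (by fun_prop) (.of_forall fun s => ?_)
  rw [Real.norm_eq_abs, abs_of_nonneg (by positivity)]
  simp only [Pi.add_apply]
  nlinarith [sq_nonneg (‖W s‖ ^ 2 - 1)]

/-- Truncation and $cp\le1$ keep the summand below $\xi\cdot8k\le1$, so $e^f\le1+f+f^2$. Its second
moment is at most $\xi^2(k+2^4k)$, as $\|\theta\|\le2$: hence the 17. -/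
lemma lintegral_exp_truncQuad_le [IsProbabilityMeasure P] (hW : Measurable W)
    (hi : Integrable (fun s => ‖W s‖ ^ 4) P) {k : ℝ} (hk : 0 < k)
    (h4 : ∀ u : Vec p, ∫ s, inner ℝ u (W s) ^ 4 ∂P ≤ k * ‖u‖ ^ 4)
    {ξ c : ℝ} (hξ : 0 < ξ) (hc : 0 ≤ c) (hcp : c * p ≤ 1) (hξk : ξ * (8 * k) ≤ 1)
    {θ : Vec p} (hθ : ‖θ‖ ≤ 2) :
    ∫⁻ s, ENNReal.ofReal (Real.exp (truncQuad W ξ c (8 * k * p) s θ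
        - ∫ s, truncQuad W ξ c (8 * k * p) s θ ∂P - 17 * ξ ^ 2 * k)) ∂P
      ≤ ENNReal.ofReal (Real.exp 0) := by
  set f := fun s => truncQuad W ξ c (8 * k * p) s θ with hf
  have hfm : Measurable f := measurable_comp₂ (measurable_truncQuad hW ξ c (8 * k * p))
    measurable_id measurable_const
  have hW2 := integrable_norm_sq_of_pow_four hW hi
  have hfi : Integrable f P := (hW2.const_mul _).mono' (by fun_prop)
    (.of_forall fun s => abs_truncQuad_le hξ.le hc _ s θ)
  have hf1 : ∀ s, f s ≤ 1 := fun s => by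
    simp only [hf, truncQuad]
    by_cases hs : s ∈ {s | ‖W s‖ ^ 2 ≤ 8 * k * p}
    · rw [indicator_of_mem hs]
      rw [mem_ofPred_eq] at hs
      have h1 : c * ‖W s‖ ^ 2 ≤ 8 * k := by
        calc c * ‖W s‖ ^ 2 ≤ c * (8 * k * p) := by gcongr
          _ = (c * p) * (8 * k) := by ring
          _ ≤ 1 * (8 * k) := by gcongr
          _ = 8 * k := one_mul _
      have h2 : 0 ≤ (inner ℝ θ (W s) : ℝ) ^ 2 := sq_nonneg _
      calc _ ≤ ξ * (8 * k) := by gcongr; linarith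
        _ ≤ 1 := hξk
    · rw [indicator_of_notMem hs]; exact zero_le_one
  have hf2 : ∀ s, f s ^ 2 ≤ ξ ^ 2 * (c ^ 2 * ‖W s‖ ^ 4 + inner ℝ θ (W s) ^ 4) := fun s => by
    simp only [hf, truncQuad]
    by_cases hs : s ∈ {s | ‖W s‖ ^ 2 ≤ 8 * k * p}
    · rw [indicator_of_mem hs, mul_pow]
      gcongr
      have h1 : 0 ≤ (c * ‖W s‖ ^ 2) * (inner ℝ θ (W s) : ℝ) ^ 2 := by positivity
      nlinarith
    · rw [indicator_of_notMem hs, zero_pow two_ne_zero]; positivity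
  have hgi : Integrable (fun s => ξ ^ 2 * (c ^ 2 * ‖W s‖ ^ 4 + inner ℝ θ (W s) ^ 4)) P :=
    ((hi.const_mul _).add (integrable_inner_pow_four hW hi θ)).const_mul _
  have hg : ∫ s, ξ ^ 2 * (c ^ 2 * ‖W s‖ ^ 4 + inner ℝ θ (W s) ^ 4) ∂P ≤ 17 * ξ ^ 2 * k := by
    rw [integral_const_mul, integral_add (hi.const_mul _) (integrable_inner_pow_four hW hi θ),
      integral_const_mul]
    have h1 : c ^ 2 * ∫ s, ‖W s‖ ^ 4 ∂P ≤ k := by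
      calc c ^ 2 * ∫ s, ‖W s‖ ^ 4 ∂P ≤ c ^ 2 * (p ^ 2 * k) := by
            gcongr; exact integral_norm_pow_four_le hW hi h4
        _ = (c * p) ^ 2 * k := by ring
        _ ≤ 1 ^ 2 * k := by gcongr
        _ = k := by ring
    have h2 : ∫ s, inner ℝ θ (W s) ^ 4 ∂P ≤ 16 * k := by
      calc _ ≤ k * ‖θ‖ ^ 4 := h4 θ
        _ ≤ k * 2 ^ 4 := by gcongr
        _ = 16 * k := by ring
    calc _ ≤ ξ ^ 2 * (k + 16 * k) := by gcongr
      _ = _ := by ring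
  have hbound : ∀ s, Real.exp (f s) ≤ 1 + f s
      + ξ ^ 2 * (c ^ 2 * ‖W s‖ ^ 4 + inner ℝ θ (W s) ^ 4) := fun s => by
    linarith [exp_le_one_add_add_sq (hf1 s), hf2 s]
  have h1f : Integrable (fun s => 1 + f s) P := (integrable_const _).add hfi
  have hexp : Integrable (fun s => Real.exp (f s)) P :=
    (h1f.add hgi).mono' (by fun_prop) (.of_forall fun s => by
      rw [Real.norm_eq_abs, abs_of_pos (Real.exp_pos _)]; exact hbound s)
  set m := ∫ s, f s ∂P with hm
  have hI : ∫ s, Real.exp (f s) ∂P ≤ Real.exp (m + 17 * ξ ^ 2 * k) := by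
    refine (integral_mono hexp (h1f.add hgi) hbound).trans ?_
    simp only [Pi.add_apply]
    rw [integral_add h1f hgi, integral_add (integrable_const _) hfi]
    simp only [integral_const, probReal_univ, one_smul]
    linarith [Real.add_one_le_exp (m + 17 * ξ ^ 2 * k)]
  have hsplit : ∀ s, Real.exp (f s - m - 17 * ξ ^ 2 * k)
      = Real.exp (-(m + 17 * ξ ^ 2 * k)) * Real.exp (f s) :=
    fun s => by rw [← Real.exp_add]; ring_nf
  change ∫⁻ s, ENNReal.ofReal (Real.exp (f s - m - 17 * ξ ^ 2 * k)) ∂P ≤ _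
  simp_rw [hsplit]
  rw [← ofReal_integral_eq_lintegral_ofReal (hexp.const_mul _)
    (.of_forall fun x => by positivity), integral_const_mul]
  refine ENNReal.ofReal_le_ofReal ?_
  calc _ ≤ Real.exp (-(m + 17 * ξ ^ 2 * k)) * Real.exp (m + 17 * ξ ^ 2 * k) := by gcongr
    _ = _ := by rw [← Real.exp_add]; ring_nf

/-- The expectation of the truncated quadratic form is at least `7 / 8` of the full one. -/
lemma integral_indicator_inner_sq_ge [IsProbabilityMeasure P] (hW : Measurable W) (hp : 0 < p)
    (hi : Integrable (fun s => ‖W s‖ ^ 4) P) {k : ℝ} (hk : 0 < k)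
    (h2 : ∀ u : Vec p, ∫ s, inner ℝ u (W s) ^ 2 ∂P = ‖u‖ ^ 2)
    (h4 : ∀ u : Vec p, ∫ s, inner ℝ u (W s) ^ 4 ∂P ≤ k * ‖u‖ ^ 4) {ξ : ℝ} (hξ : 0 < ξ)
    {u : Vec p} (hu : ‖u‖ = 1) :
    ∫ s, {s | ‖W s‖ ^ 2 ≤ 8 * k * p}.indicator (fun s => -(ξ * inner ℝ u (W s) ^ 2)) s ∂P
      ≤ -(ξ * (7 / 8)) := by
  have hp' : (0 : ℝ) < p := by exact_mod_cast hp
  obtain ⟨hi2, hb⟩ := integral_inner_sq_mul_norm_sq_le hW hi h4 hu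
  have hW2 := integrable_norm_sq_of_pow_four hW hi
  have hiu : Integrable (fun s => (inner ℝ u (W s) : ℝ) ^ 2) P :=
    hW2.mono' (by fun_prop) (.of_forall fun s => by
      rw [norm_pow]
      gcongr
      simpa [hu] using norm_inner_le_norm (𝕜 := ℝ) u (W s))
  -- Off the truncation set $1\le\|W\|^2/(8kp)$, and $E(u^TW)^2\|W\|^2\le pk$, so truncation loses
  -- at most $1/8$.
  have hle : ∀ s, {s | ‖W s‖ ^ 2 ≤ 8 * k * p}.indicator (fun s => -(ξ * inner ℝ u (W s) ^ 2)) s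
      ≤ ξ / (8 * k * p) * (inner ℝ u (W s) ^ 2 * ‖W s‖ ^ 2) - ξ * inner ℝ u (W s) ^ 2 :=
    fun s => by
    by_cases hs : s ∈ {s | ‖W s‖ ^ 2 ≤ 8 * k * p}
    · rw [indicator_of_mem hs]
      have : 0 ≤ ξ / (8 * k * p) * (inner ℝ u (W s) ^ 2 * ‖W s‖ ^ 2) := by positivity
      linarith
    · rw [indicator_of_notMem hs]
      rw [mem_ofPred_eq, not_le] at hs
      have : ξ / (8 * k * p) * (inner ℝ u (W s) ^ 2 * (8 * k * p)) ≤
        ξ / (8 * k * p) * (inner ℝ u (W s) ^ 2 * ‖W s‖ ^ 2) := by gcongr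
      have e : ξ / (8 * k * p) * (inner ℝ u (W s) ^ 2 * (8 * k * p))
        = ξ * inner ℝ u (W s) ^ 2 := by field_simp
      linarith
  calc _ ≤ ∫ s, (ξ / (8 * k * p) * (inner ℝ u (W s) ^ 2 * ‖W s‖ ^ 2)
        - ξ * inner ℝ u (W s) ^ 2) ∂P := by
        refine integral_mono ?_ ((hi2.const_mul _).sub (hiu.const_mul _)) hle
        exact (hiu.const_mul ξ).neg.indicator (measurableSet_le (by fun_prop) measurable_const)
    _ ≤ ξ / (8 * k * p) * (p * k) - ξ := by
        rw [integral_sub (hi2.const_mul _) (hiu.const_mul _), integral_const_mul,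
          integral_const_mul, h2, hu]
        have := mul_le_mul_of_nonneg_left hb (by positivity : 0 ≤ ξ / (8 * k * p))
        linarith
    _ = _ := by field_simp; ring

set_option maxHeartbeats 400000 in
/-- A lower tail bound for the smallest eigenvalue of an empirical second moment matrix, under a
fourth moment condition. -/
theorem exists_half_le_sum_inner_sq [IsProbabilityMeasure P] (hW : Measurable W) (hp : 0 < p)
    (hi : Integrable (fun s => ‖W s‖ ^ 4) P) {k : ℝ} (hk : 0 < k)
    (h2 : ∀ u : Vec p, ∫ s, inner ℝ u (W s) ^ 2 ∂P = ‖u‖ ^ 2)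
    (h4 : ∀ u : Vec p, ∫ s, inner ℝ u (W s) ^ 4 ∂P ≤ k * ‖u‖ ^ 4)
    {δ : ℝ} (hδ : 0 < δ) (hn : 544 * k * (p + Real.log (1 / δ)) ≤ n) :
    ∃ B : Set (Fin n → S), MeasurableSet B ∧
      Measure.pi (fun _ : Fin n => P) B ≤ ENNReal.ofReal δ ∧
      ∀ z ∉ B, ∀ u : Vec p, ‖u‖ = 1 → (n : ℝ) / 2 ≤ ∑ i, inner ℝ u (W (z i)) ^ 2 := by
  obtain ⟨c, hc0, hcp, hc⟩ := exists_integral_inner_sq hp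
  set Q := Measure.pi (fun _ : Fin n => P)
  -- As $136=8\cdot17$, the second-order term $17\xi^2k$ equals $\xi/8$.
  set ξ := 1 / (136 * k) with hξ
  have hξ0 : 0 < ξ := by positivity
  set f := truncQuad W ξ c (8 * k * p) with hf
  have hfm : Measurable fun q : S × Vec p => f q.1 q.2 := measurable_truncQuad hW _ _ _
  set m : Vec p → ℝ := fun θ => ∫ s, f s θ ∂P with hm
  have hmm : Measurable m :=
    (StronglyMeasurable.integral_prod_left (μ := P)
      (f := fun (s : S) (θ : Vec p) => f s θ) hfm.stronglyMeasurable).measurable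
  have hfz : ∀ i : Fin n, Measurable fun q : (Fin n → S) × Vec p => f (q.1 i) q.2 := fun i =>
      measurable_comp₂ hfm (by fun_prop) measurable_snd
  set Φ : (Fin n → S) → Vec p → ℝ := fun z θ => ∑ i, (f (z i) θ - m θ - 17 * ξ ^ 2 * k) with hΦ
  have hΦm : Measurable fun q : (Fin n → S) × Vec p => ENNReal.ofReal (Real.exp (Φ q.1 q.2)) := by
    simp only [hΦ]
    fun_prop
  have hprob := isProbabilityMeasure_ballUnif (0 : Vec p) two_pos
  set J : (Fin n → S) → ℝ≥0∞ := fun z =>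
    ∫⁻ θ, ENNReal.ofReal (Real.exp (Φ z θ)) ∂ballUnif (0 : Vec p) 2 with hJ
  have hJm : Measurable J := Measurable.lintegral_prod_right' hΦm
  have hJ1 : ∫⁻ z, J z ∂Q ≤ ENNReal.ofReal 1 := by
    simp only [hJ]
    rw [lintegral_lintegral_swap hΦm.aemeasurable]
    calc _ ≤ ∫⁻ θ, 1 ∂ballUnif (0 : Vec p) 2 := by
          refine lintegral_mono_ae ?_
          filter_upwards [ballUnif_ae_mem (0 : Vec p) 2] with θ hθ
          rw [mem_ball_zero_iff] at hθ
          have hξk : ξ * (8 * k) ≤ 1 := by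
            rw [hξ]; field_simp; norm_num
          have h1 := lintegral_exp_truncQuad_le hW hi hk h4 hξ0 hc0 hcp hξk hθ.le
          have h3 := lintegral_pi_exp_sum_le (n := n)
            (f := fun s => f s θ - m θ - 17 * ξ ^ 2 * k)
            (((measurable_comp₂ hfm measurable_id measurable_const).sub_const _).sub_const _) h1
          rw [mul_zero, Real.exp_zero, ENNReal.ofReal_one] at h3
          exact h3
      _ = _ := by simp
  refine ⟨_, measurableSet_lt measurable_const hJm,
    meas_lt_le_of_lintegral_le hJm hδ zero_le_one hJ1, fun z hz u hu => ?_⟩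
  simp only [mem_ofPred_eq, not_lt] at hz
  have := isProbabilityMeasure_ballUnif u one_pos
  have hfu : Integrable (fun q : Vec p × S => f q.2 q.1) ((ballUnif u 1).prod P) := by
    have hg : Integrable (fun q : Vec p × S => (ξ * (c + ‖q.1‖ ^ 2)) * ‖W q.2‖ ^ 2)
        ((ballUnif u 1).prod P) :=
      (integrable_ballUnif (f := fun θ : Vec p => ξ * (c + ‖θ‖ ^ 2)) (by fun_prop) u
        one_pos).mul_prod
        (integrable_norm_sq_of_pow_four hW hi)
    refine hg.mono' (measurable_comp₂ hfm measurable_snd measurable_fst).aestronglyMeasurable (.of_forall fun q => ?_)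
    exact abs_truncQuad_le hξ0.le hc0 _ _ _
  have hfs : ∀ s, Integrable (fun θ => f s θ) (ballUnif u 1) := fun s => by
    refine Integrable.mono' (g := fun θ => (ξ * (c + ‖θ‖ ^ 2)) * ‖W s‖ ^ 2)
      (integrable_ballUnif (by fun_prop) u one_pos)
      (measurable_comp₂ hfm measurable_const measurable_id).aestronglyMeasurable
      (.of_forall fun θ => abs_truncQuad_le hξ0.le hc0 _ _ _)
  have hmi : Integrable m (ballUnif u 1) := hfu.integral_prod_left
  have hmu : ∫ θ, m θ ∂ballUnif u 1 ≤ -(ξ * (7 / 8)) := by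
    simp only [hm]
    rw [integral_integral_swap hfu]
    simp_rw [hf, integral_truncQuad_ballUnif hc]
    exact integral_indicator_inner_sq_ge hW hp hi hk h2 h4 hξ0 hu
  have hterm : ∀ i, Integrable (fun θ => f (z i) θ - m θ - 17 * ξ ^ 2 * k) (ballUnif u 1) :=
    fun i => ((hfs _).sub hmi).sub (integrable_const _)
  have hΦi : Integrable (Φ z) (ballUnif u 1) := integrable_finsetSum _ fun i _ => hterm i
  -- The good event concerns only the average over the ball of radius 2, which contains the unit
  -- ball around every unit $u$; hence the bound holds for all $u$ at once.
  have key : ENNReal.ofReal (Real.exp (∫ θ, Φ z θ ∂ballUnif u 1)) ≤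
      ENNReal.ofReal ((2 / 1) ^ p) * ENNReal.ofReal (1 / δ) :=
    (ofReal_exp_integral_le hΦi).trans
      ((lintegral_ballUnif_le u one_pos (by linarith) _).trans (by gcongr))
  rw [← ENNReal.ofReal_mul (by positivity), ENNReal.ofReal_le_ofReal_iff (by positivity)] at key
  have hlog := Real.log_le_log (Real.exp_pos _) key
  rw [Real.log_exp, Real.log_mul (by positivity) (by positivity), Real.log_pow, div_one] at hlog
  have hlog2 : Real.log 2 ≤ 1 := by
    have := Real.log_le_sub_one_of_pos (two_pos : (0 : ℝ) < 2); linarith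
  have hΦe : ∫ θ, Φ z θ ∂ballUnif u 1 ≥
      -(ξ * ∑ i, inner ℝ u (W (z i)) ^ 2) + n * (ξ * (7 / 8)) - n * (17 * ξ ^ 2 * k) := by
    simp only [hΦ]
    rw [integral_finsetSum _ fun i _ => hterm i]
    have : ∀ i ∈ Finset.univ, -(ξ * inner ℝ u (W (z i)) ^ 2) + (ξ * (7 / 8)) - 17 * ξ ^ 2 * k ≤
        ∫ θ, (f (z i) θ - m θ - 17 * ξ ^ 2 * k) ∂ballUnif u 1 := fun i _ => by
      have hsub : Integrable (fun θ => f (z i) θ - m θ) (ballUnif u 1) := (hfs _).sub hmi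
      rw [integral_sub hsub (integrable_const _), integral_sub (hfs _) hmi, hf,
        integral_truncQuad_ballUnif hc]
      simp only [integral_const, probReal_univ, one_smul]
      have : -(ξ * inner ℝ u (W (z i)) ^ 2) ≤
          {s | ‖W s‖ ^ 2 ≤ 8 * k * p}.indicator (fun s => -(ξ * inner ℝ u (W s) ^ 2)) (z i) := by
        by_cases hs : z i ∈ {s | ‖W s‖ ^ 2 ≤ 8 * k * p}
        · rw [indicator_of_mem hs]
        · rw [indicator_of_notMem hs]
          have : 0 ≤ ξ * inner ℝ u (W (z i)) ^ 2 := by positivity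
          linarith
      linarith
    refine le_trans (le_of_eq ?_) (Finset.sum_le_sum this)
    rw [Finset.sum_sub_distrib, Finset.sum_add_distrib, Finset.sum_neg_distrib, Finset.mul_sum]
    simp
  have hp' : (p : ℝ) * Real.log 2 ≤ p := mul_le_of_le_one_right (by positivity) hlog2
  -- The budget is $7/8-1/8-1/4=1/2$, the last loss being $p+\log(1/\delta)\le\xi n/4$, where
  -- $544=4\cdot136$.
  have h5 : ξ * ((n : ℝ) / 2) ≤ ξ * ∑ i, inner ℝ u (W (z i)) ^ 2 := by
    have e1 : 17 * ξ ^ 2 * k = ξ * (1 / 8) := by rw [hξ]; field_simp; ring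
    have e2 : p + Real.log (1 / δ) ≤ ξ * (n / 4) := by
      rw [hξ]
      have : 1 / (136 * k) * ((n : ℝ) / 4) = n / (544 * k) := by field_simp; ring
      rw [this, le_div_iff₀ (by positivity)]
      linarith
    rw [e1] at hΦe
    linarith
  exact le_of_mul_le_mul_left h5 hξ0

end LowerTail

/-! ### Uniform deviation of the multiplier process. -/

section MultiplierProcess

variable {φ : S → ℝ → ℝ} {υ : ℝ}

lemma measurable_multSummand (hW : Measurable W) (hφ : Measurable fun q : S × ℝ => φ q.1 q.2) :
    Measurable fun q : S × Vec p => multSummand W φ q.1 q.2 := by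
  simp only [multSummand]
  have h1 : Measurable fun q : S × Vec p => φ q.1 (inner ℝ q.2 (W q.1)) :=
    measurable_comp₂ hφ measurable_fst (by fun_prop)
  fun_prop

lemma integrable_multSummand (hW : Measurable W) (hφ : Measurable fun q : S × ℝ => φ q.1 q.2)
    (hl : ∀ s a b, |φ s a - φ s b| ≤ |a - b|) (h0 : ∀ s, φ s 0 = 0)
    (hW2 : Integrable (fun s => ‖W s‖ ^ 2) P) (v : Vec p) :
    Integrable (fun s => multSummand W φ s v) P := by
  refine (hW2.const_mul ‖v‖).mono' ?_ (.of_forall fun s => ?_)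
  · exact (measurable_comp₂ (measurable_multSummand hW hφ) measurable_id
      measurable_const).aestronglyMeasurable
  · have := norm_multSummand_sub_le (W := W) hl s v 0
    simpa [multSummand, h0] using this

/-- By the Lipschitz property a difference quotient is at most $2|a||b|\le a^2+b^2$, with $a,b$
projections of $W$ on vectors of norm at most 1. Convexity of $\exp$ reduces it to the two
sub-Gaussian bounds, so Bernstein applies with $K=8\upsilon^2$. -/
lemma lintegral_exp_increment_le [IsProbabilityMeasure P] (hW : Measurable W)
    (hφ : Measurable fun q : S × ℝ => φ q.1 q.2)
    (hl : ∀ s a b, |φ s a - φ s b| ≤ |a - b|) (h0 : ∀ s, φ s 0 = 0)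
    (hW2 : Integrable (fun s => ‖W s‖ ^ 2) P) (hυ : 0 < υ)
    (hsg : ∀ u : Vec p, ‖u‖ ≤ 1 →
      ∫⁻ s, ENNReal.ofReal (Real.exp (inner ℝ u (W s) ^ 2 / (4 * υ ^ 2))) ∂P ≤ ENNReal.ofReal 3)
    {η : ℝ} (hη : 0 ≤ η) (hηK : 2 * (η * (8 * υ ^ 2)) ≤ 1) {u : Vec p} (hu : ‖u‖ ≤ 2)
    (x y : Vec p) :
    ∫⁻ s, ENNReal.ofReal (Real.exp (η *
        (inner ℝ u (multSummand W φ s x - multSummand W φ s y) / ‖x - y‖ -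
          inner ℝ u (∫ s, multSummand W φ s x ∂P - ∫ s, multSummand W φ s y ∂P) / ‖x - y‖))) ∂P
      ≤ ENNReal.ofReal (Real.exp (24 * (η * (8 * υ ^ 2)) ^ 2)) := by
  have hm : ∀ v, Measurable fun s => multSummand W φ s v := fun v =>
    measurable_comp₂ (measurable_multSummand hW hφ) measurable_id measurable_const
  have hix := integrable_multSummand hW hφ hl h0 hW2 x
  have hiy := integrable_multSummand hW hφ hl h0 hW2 y
  set ξ : S → ℝ := fun s => inner ℝ u (multSummand W φ s x - multSummand W φ s y) / ‖x - y‖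
    with hξ
  have hξm : Measurable ξ := by
    have := hm x; have := hm y; fun_prop
  have hmean : ∫ s, ξ s ∂P =
      inner ℝ u (∫ s, multSummand W φ s x ∂P - ∫ s, multSummand W φ s y ∂P) / ‖x - y‖ := by
    simp only [hξ]
    have hi : Integrable (fun s => multSummand W φ s x - multSummand W φ s y) P := hix.sub hiy
    rw [integral_div, integral_inner hi, integral_sub hix hiy]
  rw [← hmean]
  refine lintegral_exp_centered_le hξm (by positivity) hη hηK ?_
  set e : Vec p := ‖x - y‖⁻¹ • (x - y) with he
  have hen : ‖e‖ ≤ 1 := by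
    rw [he, norm_smul, norm_inv, norm_norm]
    exact inv_mul_le_one
  have hun : ‖(1 / 2 : ℝ) • u‖ ≤ 1 := by
    rw [norm_smul, Real.norm_eq_abs, abs_of_pos (by norm_num)]; linarith
  have hpt : ∀ s, Real.exp (|ξ s| / (8 * υ ^ 2)) ≤
      1 / 2 * Real.exp (inner ℝ ((1 / 2 : ℝ) • u) (W s) ^ 2 / (4 * υ ^ 2)) +
      1 / 2 * Real.exp (inner ℝ e (W s) ^ 2 / (4 * υ ^ 2)) := fun s => by
    set a : ℝ := inner ℝ ((1 / 2 : ℝ) • u) (W s) with ha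
    set b : ℝ := inner ℝ e (W s) with hb
    have h1 : |ξ s| ≤ 2 * (|a| * |b|) := by
      have h2 := abs_inner_multSummand_sub_le (W := W) hl s u x y
      simp only [hξ]
      rw [abs_div, abs_of_nonneg (norm_nonneg (x - y)), ha, hb, he, real_inner_smul_left,
        real_inner_smul_left, abs_mul, abs_mul, abs_of_nonneg (inv_nonneg.2 (norm_nonneg (x - y))),
        abs_of_pos (by norm_num : (0 : ℝ) < 1 / 2), div_eq_mul_inv]
      calc _ ≤ (|inner ℝ u (W s)| * |inner ℝ (x - y) (W s)|) * ‖x - y‖⁻¹ := by gcongr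
        _ = _ := by ring
    have h2 : |ξ s| / (8 * υ ^ 2) ≤ 1 / 2 * (a ^ 2 / (4 * υ ^ 2)) + 1 / 2 * (b ^ 2 / (4 * υ ^ 2)) := by
      have : 1 / 2 * (a ^ 2 / (4 * υ ^ 2)) + 1 / 2 * (b ^ 2 / (4 * υ ^ 2))
        = (a ^ 2 + b ^ 2) / (8 * υ ^ 2) := by field_simp; ring
      rw [this]
      gcongr
      nlinarith [sq_nonneg (|a| - |b|), sq_abs a, sq_abs b]
    refine (Real.exp_le_exp.2 h2).trans ?_
    have := convexOn_exp.2 (mem_univ (a ^ 2 / (4 * υ ^ 2))) (mem_univ (b ^ 2 / (4 * υ ^ 2)))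
      (by norm_num : (0 : ℝ) ≤ 1 / 2) (by norm_num : (0 : ℝ) ≤ 1 / 2) (by norm_num)
    simpa using this
  calc _ ≤ ∫⁻ s, (ENNReal.ofReal (1 / 2) * ENNReal.ofReal
          (Real.exp (inner ℝ ((1 / 2 : ℝ) • u) (W s) ^ 2 / (4 * υ ^ 2))) +
        ENNReal.ofReal (1 / 2) * ENNReal.ofReal
          (Real.exp (inner ℝ e (W s) ^ 2 / (4 * υ ^ 2)))) ∂P := by
        refine lintegral_mono fun s => ?_
        rw [← ENNReal.ofReal_mul (by norm_num), ← ENNReal.ofReal_mul (by norm_num),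
          ← ENNReal.ofReal_add (by positivity) (by positivity)]
        exact ENNReal.ofReal_le_ofReal (hpt s)
    _ ≤ ENNReal.ofReal (1 / 2) * ENNReal.ofReal 3 + ENNReal.ofReal (1 / 2) * ENNReal.ofReal 3 := by
        rw [lintegral_add_left (by fun_prop), lintegral_const_mul _ (by fun_prop),
          lintegral_const_mul _ (by fun_prop)]
        gcongr
        · exact hsg _ hun
        · exact hsg _ hen
    _ = ENNReal.ofReal 3 := by
        rw [← ENNReal.ofReal_mul (by norm_num), ← ENNReal.ofReal_add (by norm_num) (by norm_num)]
        norm_num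

set_option maxHeartbeats 400000 in
/-- A uniform deviation bound for a multiplier empirical process indexed by the unit ball, with
sub-Gaussian covariates and Lipschitz multipliers. -/
theorem exists_norm_sum_multSummand_le [IsProbabilityMeasure P] (hW : Measurable W)
    (hφ : Measurable fun q : S × ℝ => φ q.1 q.2)
    (hl : ∀ s a b, |φ s a - φ s b| ≤ |a - b|) (h0 : ∀ s, φ s 0 = 0)
    (hW2 : Integrable (fun s => ‖W s‖ ^ 2) P) (hυ : 0 < υ)
    (hsg : ∀ u : Vec p, ‖u‖ ≤ 1 →
      ∫⁻ s, ENNReal.ofReal (Real.exp (inner ℝ u (W s) ^ 2 / (4 * υ ^ 2))) ∂P ≤ ENNReal.ofReal 3)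
    {δ : ℝ} (hδ : 0 < δ) (hδ1 : δ ≤ 1 / 3) (hn : p + Real.log (1 / δ) ≤ n) :
    ∃ B : Set (Fin n → S), MeasurableSet B ∧
      Measure.pi (fun _ : Fin n => P) B ≤ ENNReal.ofReal δ ∧
      ∀ z ∉ B, ∀ v : Vec p, ‖v‖ ≤ 1 →
        ‖∑ i, multSummand W φ (z i) v - (n : ℝ) • ∫ s, multSummand W φ s v ∂P‖ ≤
          2320 * υ ^ 2 * (√((p + Real.log (1 / δ)) / n) * n) := by
  set Q := Measure.pi (fun _ : Fin n => P)
  set t := Real.log (1 / δ) with ht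
  -- This is where $\delta\le1/3$ enters, through $e<3$; it lets constants be absorbed into $t$.
  have ht1 : 1 ≤ t := by
    rw [ht, Real.le_log_iff_exp_le (by positivity)]
    have h3 : (3 : ℝ) ≤ 1 / δ := by rw [le_div_iff₀ hδ]; linarith
    linarith [Real.exp_one_lt_d9]
  have hpt : 0 < p + t := by positivity
  have hn0 : (0 : ℝ) < n := hpt.trans_le hn
  set ρ := √((p + t) / n) with hρ
  have hρ0 : 0 < ρ := Real.sqrt_pos.2 (by positivity)
  have hρ1 : ρ ≤ 1 := Real.sqrt_le_one.2 ((div_le_one hn0).2 hn)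
  have hρ2 : ρ ^ 2 * n = p + t := by
    rw [hρ, Real.sq_sqrt (by positivity)]; field_simp
  -- Makes $\eta K=\rho/2\le1/2$, and the $n$ summands contribute $24n(\rho/2)^2=6(p+t)$ to the
  -- exponent.
  set η := ρ / (16 * υ ^ 2) with hη
  have hη0 : 0 < η := by positivity
  have hηK : η * (8 * υ ^ 2) = ρ / 2 := by rw [hη]; field_simp; norm_num
  set μv : Vec p → Vec p := fun v => ∫ s, multSummand W φ s v ∂P with hμ
  have hψm := measurable_multSummand hW hφ
  have hμl : ∀ x y, ‖μv x - μv y‖ ≤ (∫ s, ‖W s‖ ^ 2 ∂P) * ‖x - y‖ := fun x y => by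
    simp only [hμ]
    rw [← integral_sub (integrable_multSummand hW hφ hl h0 hW2 x)
      (integrable_multSummand hW hφ hl h0 hW2 y), mul_comm, ← integral_const_mul]
    exact norm_integral_le_of_norm_le (hW2.const_mul _)
      (.of_forall fun s => norm_multSummand_sub_le hl s x y)
  have hμc : Continuous μv := by
    have : LipschitzWith ⟨∫ s, ‖W s‖ ^ 2 ∂P, integral_nonneg fun s => by positivity⟩ μv :=
      LipschitzWith.of_dist_le_mul fun x y => by
        rw [dist_eq_norm, dist_eq_norm]; exact hμl x y
    exact this.continuous
  set g : (Fin n → S) → Vec p → Vec p :=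
    fun z v => ∑ i, multSummand W φ (z i) v - (n : ℝ) • μv v with hg
  have hgc : ∀ z, Continuous (g z) := fun z => by
    have : ∀ s, Continuous fun v => multSummand W φ s v := fun s => by
      have : LipschitzWith ⟨‖W s‖ ^ 2, by positivity⟩ fun v => multSummand W φ s v :=
        LipschitzWith.of_dist_le_mul fun x y => by
          rw [dist_eq_norm, dist_eq_norm, mul_comm]; exact norm_multSummand_sub_le hl s x y
      exact this.continuous
    simp only [hg]
    fun_prop
  have hgm : Measurable fun q : (Fin n → S) × Vec p => g q.1 q.2 := by
    have : ∀ i : Fin n, Measurable fun q : (Fin n → S) × Vec p => multSummand W φ (q.1 i) q.2 :=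
      fun i => measurable_comp₂ hψm (by fun_prop) measurable_snd
    have := hμc.measurable
    simp only [hg]
    fun_prop
  have hprob := isProbabilityMeasure_ballUnif (0 : Vec p) two_pos
  set π := ballUnif (0 : Vec p) 2 with hπ
  set F : (Fin n → S) → Vec p × Vec p × Vec p → ℝ≥0∞ := fun z q => ENNReal.ofReal
    (1 + Real.exp (η * (inner ℝ q.1 (g z q.2.1 - g z q.2.2) / ‖q.2.1 - q.2.2‖))) with hF
  have hFm : Measurable fun q : (Fin n → S) × (Vec p × Vec p × Vec p) => F q.1 q.2 := by
    have h1 : Measurable fun q : (Fin n → S) × (Vec p × Vec p × Vec p) => g q.1 q.2.2.1 :=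
      measurable_comp₂ hgm measurable_fst (by fun_prop)
    have h2 : Measurable fun q : (Fin n → S) × (Vec p × Vec p × Vec p) => g q.1 q.2.2.2 :=
      measurable_comp₂ hgm measurable_fst (by fun_prop)
    simp only [hF]
    fun_prop
  -- One random variable carries all increments: its mean is bounded by Fubini, and a single use of
  -- Markov's inequality defines the bad event.
  set J : (Fin n → S) → ℝ≥0∞ := fun z => ∫⁻ q, F z q ∂(π.prod (π.prod π)) with hJ
  have hJm : Measurable J := Measurable.lintegral_prod_right' hFm
  have hincr : ∀ u : Vec p, ‖u‖ ≤ 2 → ∀ x y : Vec p,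
      ∫⁻ z, F z (u, x, y) ∂Q ≤ ENNReal.ofReal (2 * Real.exp (6 * (p + t))) := by
    intro u hu x y
    have h1 := lintegral_exp_increment_le hW hφ hl h0 hW2 hυ hsg hη0.le
      (by rw [hηK]; linarith) hu x y
    have hm : ∀ v, Measurable fun s => multSummand W φ s v := fun v =>
      measurable_comp₂ hψm measurable_id measurable_const
    have h3 := lintegral_pi_exp_sum_le (n := n) (P := P)
      (by have := hm x; have := hm y; fun_prop) h1
    have e : (n : ℝ) * (24 * (η * (8 * υ ^ 2)) ^ 2) = 6 * (p + t) := by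
      rw [hηK, ← hρ2]; ring
    rw [e] at h3
    have h4 : ∀ z : Fin n → S, F z (u, x, y) = 1 + ENNReal.ofReal (Real.exp (∑ i, η *
        (inner ℝ u (multSummand W φ (z i) x - multSummand W φ (z i) y) / ‖x - y‖ -
          inner ℝ u (μv x - μv y) / ‖x - y‖))) := fun z => by
      simp only [hF]
      rw [ENNReal.ofReal_add zero_le_one (Real.exp_pos _).le, ENNReal.ofReal_one]
      congr 4
      simp only [hg]
      rw [← Finset.mul_sum]
      congr 1
      rw [Finset.sum_sub_distrib, ← Finset.sum_div, ← inner_sum, Finset.sum_sub_distrib,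
        Finset.sum_const, Finset.card_univ, Fintype.card_fin, nsmul_eq_mul, ← mul_div_assoc,
        ← sub_div, ← real_inner_smul_right, ← inner_sub_right]
      congr 2
      rw [smul_sub]
      abel
    simp_rw [h4]
    rw [lintegral_add_left measurable_const]
    simp only [lintegral_const, measure_univ, mul_one]
    calc _ ≤ 1 + ENNReal.ofReal (Real.exp (6 * (p + t))) := by gcongr
      _ = ENNReal.ofReal (1 + Real.exp (6 * (p + t))) := by
          rw [ENNReal.ofReal_add zero_le_one (Real.exp_pos _).le, ENNReal.ofReal_one]
      _ ≤ _ := by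
          refine ENNReal.ofReal_le_ofReal ?_
          have : 1 ≤ Real.exp (6 * (p + t)) := Real.one_le_exp (by positivity)
          linarith
  have hJ1 : ∫⁻ z, J z ∂Q ≤ ENNReal.ofReal (2 * Real.exp (6 * (p + t))) := by
    simp only [hJ]
    rw [lintegral_lintegral_swap hFm.aemeasurable]
    calc _ ≤ ∫⁻ q, ENNReal.ofReal (2 * Real.exp (6 * (p + t))) ∂(π.prod (π.prod π)) := by
          refine lintegral_mono_ae ?_
          have hmem : ∀ᵐ q ∂(π.prod (π.prod π)), q.1 ∈ ball (0 : Vec p) 2 :=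
            Measure.quasiMeasurePreserving_fst.ae (ballUnif_ae_mem (0 : Vec p) 2)
          filter_upwards [hmem] with q hq
          rw [mem_ball_zero_iff] at hq
          exact hincr q.1 hq.le q.2.1 q.2.2
      _ = _ := by simp
  refine ⟨_, measurableSet_lt measurable_const hJm,
    meas_lt_le_of_lintegral_le hJm hδ (by positivity) hJ1, fun z hz v hv => ?_⟩
  simp only [mem_ofPred_eq, not_lt] at hz
  have hFz : Measurable (F z) :=
    measurable_comp₂ hFm measurable_const measurable_id
  have hJz : ∫⁻ u, ∫⁻ x, ∫⁻ y, ENNReal.ofReal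
        (1 + Real.exp (η * (inner ℝ u (g z x - g z y) / ‖x - y‖))) ∂π ∂π ∂π
      ≤ ENNReal.ofReal (Real.exp (8 * (p + t))) := by
    have e : J z = ∫⁻ u, ∫⁻ x, ∫⁻ y, F z (u, x, y) ∂π ∂π ∂π := by
      simp only [hJ]
      rw [lintegral_prod _ hFz.aemeasurable]
      refine lintegral_congr fun u => ?_
      rw [lintegral_prod _ (by fun_prop)]
    rw [e] at hz
    refine hz.trans (ENNReal.ofReal_le_ofReal ?_)
    have h2 : (2 : ℝ) ≤ Real.exp 1 := by linarith [Real.add_one_le_exp (1 : ℝ)]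
    have h1 : 1 / δ = Real.exp t := by rw [ht, Real.exp_log (by positivity)]
    calc 2 * Real.exp (6 * (p + t)) / δ = 2 * Real.exp (6 * (p + t)) * (1 / δ) := by ring
      _ ≤ Real.exp 1 * Real.exp (6 * (p + t)) * Real.exp t := by rw [h1]; gcongr
      _ = Real.exp (1 + 6 * (p + t) + t) := by rw [← Real.exp_add, ← Real.exp_add]
      _ ≤ _ := by
          rw [Real.exp_le_exp]
          have : (0 : ℝ) ≤ p := by positivity
          linarith
  have hfin := norm_sub_le_of_lintegral_exp (hgc z) hη0 (by positivity) hJz hv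
  have hg0 : g z 0 = 0 := by
    simp [hg, hμ, multSummand, h0]
  rw [hg0, sub_zero] at hfin
  refine hfin.trans ?_
  -- Chaining with $T=8(p+t)$ gives $88(p+t)+57p\le145(p+t)$, and $2320=145\cdot16$.
  have e : 2320 * υ ^ 2 * (ρ * n) = 145 * (p + t) / η := by
    rw [← hρ2, hη]; field_simp; norm_num
  rw [e]
  gcongr
  linarith

end MultiplierProcess

end EmpiricalProcess

/-! ### Moments from sub-Gaussian tails. -/

section SubGaussianMoments

open Filter Topology
open scoped ENNReal

variable {S : Type*} [MeasurableSpace S] {P : Measure S} {p : ℕ} {W : S → Vec p} {υ : ℝ}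

/-- Layer cake: the tail at level $t>1$ is at most $2t^{-2}$, so the integral is at most
$1+2\int_1^\infty t^{-2}\,dt=3$. -/
lemma lintegral_exp_sq_le_of_tail [IsProbabilityMeasure P] {a : S → ℝ} (ha : Measurable a)
    (hυ : 0 < υ)
    (h : ∀ t : ℝ, 0 ≤ t → P.real {s | υ * t ≤ |a s|} ≤ 2 * Real.exp (-t ^ 2 / 2)) :
    ∫⁻ s, ENNReal.ofReal (Real.exp (a s ^ 2 / (4 * υ ^ 2))) ∂P ≤ ENNReal.ofReal 3 := by
  rw [lintegral_eq_lintegral_meas_le P (.of_forall fun s => (Real.exp_pos _).le) (by fun_prop)]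
  have hsplit : Ioi (0 : ℝ) = Ioc 0 1 ∪ Ioi 1 := (Ioc_union_Ioi_eq_Ioi zero_le_one).symm
  have hint : IntegrableOn (fun t : ℝ => 2 * t ^ (-2 : ℝ)) (Ioi 1) :=
    (integrableOn_Ioi_rpow_of_lt (by norm_num) one_pos).const_mul 2
  calc _ ≤ (∫⁻ t in Ioc (0 : ℝ) 1, P {s | t ≤ Real.exp (a s ^ 2 / (4 * υ ^ 2))})
        + ∫⁻ t in Ioi (1 : ℝ), P {s | t ≤ Real.exp (a s ^ 2 / (4 * υ ^ 2))} := by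
        rw [hsplit]; exact lintegral_union_le _ _ _
    _ ≤ (∫⁻ _t in Ioc (0 : ℝ) 1, 1) + ∫⁻ t in Ioi (1 : ℝ), ENNReal.ofReal (2 * t ^ (-2 : ℝ)) := by
        refine add_le_add (lintegral_mono fun t => prob_le_one)
          (setLIntegral_mono' measurableSet_Ioi fun t ht => ?_)
        rw [mem_Ioi] at ht
        have ht0 : 0 < t := by linarith
        have hlog : 0 ≤ Real.log t := Real.log_nonneg ht.le
        have hsq : √(4 * Real.log t) ^ 2 = 4 * Real.log t := Real.sq_sqrt (by positivity)
        have hset : {s | t ≤ Real.exp (a s ^ 2 / (4 * υ ^ 2))} ⊆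
            {s | υ * √(4 * Real.log t) ≤ |a s|} := by
          intro s hs
          rw [mem_ofPred_eq] at hs ⊢
          rw [← Real.log_le_iff_le_exp ht0, le_div_iff₀ (by positivity)] at hs
          refine abs_le_of_sq_le_sq' ?_ (abs_nonneg _) |>.2
          rw [mul_pow, hsq, sq_abs]
          linarith
        have hb := h (√(4 * Real.log t)) (Real.sqrt_nonneg _)
        have he : Real.exp (-√(4 * Real.log t) ^ 2 / 2) = t ^ (-2 : ℝ) := by
          rw [hsq, Real.rpow_def_of_pos ht0]; ring_nf
        rw [he] at hb
        calc _ ≤ P {s | υ * √(4 * Real.log t) ≤ |a s|} := measure_mono hset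
          _ = ENNReal.ofReal (P.real {s | υ * √(4 * Real.log t) ≤ |a s|}) :=
              (ofReal_measureReal).symm
          _ ≤ _ := ENNReal.ofReal_le_ofReal hb
    _ = ENNReal.ofReal 3 := by
        rw [← ofReal_integral_eq_lintegral_ofReal hint]
        · rw [integral_const_mul, integral_Ioi_rpow_of_lt (by norm_num) one_pos]
          simp only [lintegral_const, Measure.restrict_apply_univ, Real.volume_Ioc]
          rw [one_mul, ← ENNReal.ofReal_add (by norm_num) (by norm_num)]
          norm_num
        · filter_upwards [ae_restrict_mem measurableSet_Ioi] with t ht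
          have : (0 : ℝ) < t := one_pos.trans ht
          simp only [Pi.zero_apply]
          positivity

lemma lintegral_exp_inner_sq_le [IsProbabilityMeasure P] (hW : Measurable W) (hυ : 0 < υ)
    (h : ∀ u : Vec p, ‖u‖ = 1 → ∀ t : ℝ, 0 ≤ t →
      P.real {s | υ * t ≤ |inner ℝ u (W s)|} ≤ 2 * Real.exp (-t ^ 2 / 2))
    {u : Vec p} (hu : ‖u‖ ≤ 1) :
    ∫⁻ s, ENNReal.ofReal (Real.exp (inner ℝ u (W s) ^ 2 / (4 * υ ^ 2))) ∂P ≤ ENNReal.ofReal 3 := by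
  rcases eq_or_ne u 0 with rfl | hu0
  · simp only [inner_zero_left]
    norm_num
  · have hn : 0 < ‖u‖ := norm_pos_iff.2 hu0
    refine le_trans (lintegral_mono fun s => ENNReal.ofReal_le_ofReal (Real.exp_le_exp.2 ?_))
      (lintegral_exp_sq_le_of_tail (a := fun s => inner ℝ (‖u‖⁻¹ • u) (W s)) (by fun_prop) hυ
        (h _ (by rw [norm_smul, norm_inv, norm_norm, inv_mul_cancel₀ hn.ne'])))
    gcongr ?_ / _
    have : (inner ℝ u (W s) : ℝ) = ‖u‖ * inner ℝ (‖u‖⁻¹ • u) (W s) := by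
      rw [real_inner_smul_left, mul_inv_cancel_left₀ hn.ne']
    rw [this, mul_pow]
    exact mul_le_of_le_one_left (sq_nonneg _) (pow_le_one₀ hn.le hu)

lemma integrable_norm_pow_four_of_subGaussian [IsProbabilityMeasure P] (hW : Measurable W)
    (hυ : 0 < υ)
    (hsg : ∀ u : Vec p, ‖u‖ ≤ 1 →
      ∫⁻ s, ENNReal.ofReal (Real.exp (inner ℝ u (W s) ^ 2 / (4 * υ ^ 2))) ∂P ≤ ENNReal.ofReal 3) :
    Integrable (fun s => ‖W s‖ ^ 4) P := by
  have h1 : ∀ j : Fin p, Integrable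
      (fun s => inner ℝ (EuclideanSpace.single j (1 : ℝ)) (W s) ^ 4) P := fun j => by
    have hE : Integrable (fun s => Real.exp
        (inner ℝ (EuclideanSpace.single j (1 : ℝ)) (W s) ^ 2 / (4 * υ ^ 2))) P :=
      (lintegral_ofReal_ne_top_iff_integrable (by fun_prop)
        (.of_forall fun x => (Real.exp_pos _).le)).1
        ((hsg _ (by simp)).trans_lt ENNReal.ofReal_lt_top).ne
    refine (hE.const_mul (32 * υ ^ 4)).mono' (by fun_prop) (.of_forall fun s => ?_)
    set x : ℝ := inner ℝ (EuclideanSpace.single j (1 : ℝ)) (W s)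
    have h2 := Real.quadratic_le_exp_of_nonneg (x := x ^ 2 / (4 * υ ^ 2)) (by positivity)
    have h3 : (x ^ 2 / (4 * υ ^ 2)) ^ 2 ≤ 2 * Real.exp (x ^ 2 / (4 * υ ^ 2)) := by
      have : 0 ≤ x ^ 2 / (4 * υ ^ 2) := by positivity
      linarith
    have e : x ^ 4 = 16 * υ ^ 4 * (x ^ 2 / (4 * υ ^ 2)) ^ 2 := by field_simp; ring
    rw [Real.norm_eq_abs, abs_of_nonneg (by positivity), e]
    calc _ ≤ 16 * υ ^ 4 * (2 * Real.exp (x ^ 2 / (4 * υ ^ 2))) := by gcongr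
      _ = _ := by ring
  refine Integrable.mono' ((integrable_finsetSum Finset.univ fun j _ => h1 j).const_mul (p : ℝ))
    (by fun_prop) (.of_forall fun s => ?_)
  rw [Real.norm_eq_abs, abs_of_nonneg (by positivity)]
  have := sq_sum_le_card_mul_sum_sq (s := Finset.univ)
    (f := fun j : Fin p => (inner ℝ (EuclideanSpace.single j (1 : ℝ)) (W s) : ℝ) ^ 2)
  rw [← norm_sq_eq_sum_inner, Finset.card_univ, Fintype.card_fin] at this
  calc ‖W s‖ ^ 4 = (‖W s‖ ^ 2) ^ 2 := by ring
    _ ≤ _ := this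
    _ = _ := by
      congr 1
      exact Finset.sum_congr rfl fun j _ => by ring

end SubGaussianMoments

/-! ### The standardized covariate. -/

section Standardization

variable {p : ℕ}

lemma mulVecE_eq (A : Matrix (Fin p) (Fin p) ℝ) (u : Vec p) :
    mulVecE A u = Matrix.toEuclideanCLM (𝕜 := ℝ) A u := by
  ext i
  rw [Matrix.ofLp_toEuclideanCLM, mulVecE]

lemma mulVecE_mulVecE (A B : Matrix (Fin p) (Fin p) ℝ) (u : Vec p) :
    mulVecE A (mulVecE B u) = mulVecE (A * B) u := by
  simp [mulVecE, Matrix.mulVec_mulVec]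

lemma mulVecE_one (u : Vec p) : mulVecE 1 u = u := by
  simp [mulVecE]

lemma continuous_mulVecE (A : Matrix (Fin p) (Fin p) ℝ) : Continuous (mulVecE A) := by
  have : mulVecE A = Matrix.toEuclideanCLM (𝕜 := ℝ) A := funext (mulVecE_eq A)
  rw [this]
  exact ContinuousLinearMap.continuous _

lemma norm_mulVecE_le (A : Matrix (Fin p) (Fin p) ℝ) (u : Vec p) :
    ‖mulVecE A u‖ ≤ ‖Matrix.toEuclideanCLM (𝕜 := ℝ) A‖ * ‖u‖ := by
  rw [mulVecE_eq]; exact ContinuousLinearMap.le_opNorm _ _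

lemma inner_mulVecE {A : Matrix (Fin p) (Fin p) ℝ} (hA : A.IsHermitian) (u v : Vec p) :
    inner ℝ (mulVecE A u) v = inner ℝ u (mulVecE A v) := by
  have hT : A.transpose = A := (Matrix.conjTranspose_eq_transpose_of_trivial A).symm.trans hA
  simp only [EuclideanSpace.inner_eq_star_dotProduct, mulVecE, star_trivial]
  rw [Matrix.dotProduct_mulVec, ← Matrix.mulVec_transpose, hT, dotProduct_comm]

variable {P : Measure (Vec p × ℝ)}

lemma measurable_standardize : Measurable fun z : Vec p × ℝ => standardize P z.1 :=
  (continuous_mulVecE _).measurable.comp measurable_fst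

lemma isHermitian_sqrt (A : Matrix (Fin p) (Fin p) ℝ) : (CFC.sqrt A).IsHermitian :=
  (Matrix.nonneg_iff_posSemidef.1 (CFC.sqrt_nonneg A)).isHermitian

lemma sqrt_mul_sqrt_secondMoment (hpos : (secondMoment P).PosDef) :
    CFC.sqrt (secondMoment P) * CFC.sqrt (secondMoment P) = secondMoment P :=
  CFC.sqrt_mul_sqrt_self _ (Matrix.nonneg_iff_posSemidef.2 hpos.posSemidef)

lemma isUnit_det_sqrt (hpos : (secondMoment P).PosDef) :
    IsUnit (CFC.sqrt (secondMoment P)).det := by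
  have h := congrArg Matrix.det (sqrt_mul_sqrt_secondMoment hpos)
  rw [Matrix.det_mul] at h
  rw [isUnit_iff_ne_zero]
  intro h0
  rw [h0, zero_mul] at h
  exact hpos.det_pos.ne h

lemma mulVecE_sqrt_standardize (hpos : (secondMoment P).PosDef) (x : Vec p) :
    mulVecE (CFC.sqrt (secondMoment P)) (standardize P x) = x := by
  rw [standardize, mulVecE_mulVecE, Matrix.mul_nonsing_inv _ (isUnit_det_sqrt hpos), mulVecE_one]

lemma inner_eq_inner_standardize (hpos : (secondMoment P).PosDef) (x d : Vec p) :
    inner ℝ x d = inner ℝ (mulVecE (CFC.sqrt (secondMoment P)) d) (standardize P x) := by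
  rw [inner_mulVecE (isHermitian_sqrt _), mulVecE_sqrt_standardize hpos, real_inner_comm]

/-- Isotropy of $W$: with $a=\Sigma^{-1/2}u$ one has $u^TW=a^TX$, and $a^T\Sigma
a=\|\Sigma^{1/2}a\|^2=\|u\|^2$. -/
lemma integral_inner_standardize_sq (hpos : (secondMoment P).PosDef)
    (hi : Integrable (fun z => ‖standardize P z.1‖ ^ 2) P) (u : Vec p) :
    ∫ z, inner ℝ u (standardize P z.1) ^ 2 ∂P = ‖u‖ ^ 2 := by
  set R := CFC.sqrt (secondMoment P) with hR
  have hRi : R⁻¹.IsHermitian := (isHermitian_sqrt _).inv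
  set a := mulVecE R⁻¹ u with ha
  have hRa : mulVecE R a = u := by
    rw [ha, mulVecE_mulVecE, Matrix.mul_nonsing_inv _ (isUnit_det_sqrt hpos), mulVecE_one]
  have hx : Integrable (fun z : Vec p × ℝ => ‖z.1‖ ^ 2) P := by
    refine (hi.const_mul (‖Matrix.toEuclideanCLM (𝕜 := ℝ) R‖ ^ 2)).mono' (by fun_prop)
      (.of_forall fun z => ?_)
    rw [Real.norm_eq_abs, abs_of_nonneg (by positivity), ← mul_pow]
    gcongr
    conv_lhs => rw [← mulVecE_sqrt_standardize hpos z.1]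
    exact norm_mulVecE_le _ _
  have hxx : ∀ i j : Fin p, Integrable (fun z : Vec p × ℝ => z.1 i * z.1 j) P := fun i j => by
    refine hx.mono' (by fun_prop) (.of_forall fun z => ?_)
    rw [norm_mul, sq]
    exact mul_le_mul (PiLp.norm_apply_le z.1 i) (PiLp.norm_apply_le z.1 j) (norm_nonneg _)
      (norm_nonneg _)
  have h1 : ∀ z : Vec p × ℝ, inner ℝ u (standardize P z.1) ^ 2
      = ∑ i, ∑ j, a i * a j * (z.1 i * z.1 j) := fun z => by
    rw [standardize, ← inner_mulVecE hRi, ← ha, EuclideanSpace.inner_eq_star_dotProduct, sq,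
      dotProduct, Finset.sum_mul_sum]
    refine Finset.sum_congr rfl fun i _ => Finset.sum_congr rfl fun j _ => ?_
    simp
    ring
  simp_rw [h1]
  rw [integral_finsetSum _ fun i _ => integrable_finsetSum _ fun j _ => (hxx i j).const_mul _]
  have h2 : ∑ i, ∫ z, ∑ j, a i * a j * (z.1 i * z.1 j) ∂P
      = inner ℝ a (mulVecE (secondMoment P) a) := by
    rw [EuclideanSpace.inner_eq_star_dotProduct, dotProduct]
    refine Finset.sum_congr rfl fun i _ => ?_
    rw [integral_finsetSum _ fun j _ => (hxx i j).const_mul _]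
    simp only [mulVecE, Matrix.mulVec, dotProduct, Finset.sum_mul]
    refine Finset.sum_congr rfl fun j _ => ?_
    rw [integral_const_mul, secondMoment, Matrix.of_apply]
    simp
    ring
  rw [h2, ← sqrt_mul_sqrt_secondMoment hpos, ← mulVecE_mulVecE, ← inner_mulVecE (isHermitian_sqrt _),
    hRa, real_inner_self_eq_norm_sq]

/-! ### The moment constants $\kappa_l$. -/

section Kappa

lemma integrable_norm_pow_le [IsFiniteMeasure P] {W : Vec p × ℝ → Vec p} (hW : Measurable W)
    (hi : Integrable (fun z => ‖W z‖ ^ 4) P) {l : ℕ} (hl : l ≤ 4) :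
    Integrable (fun z => ‖W z‖ ^ l) P := by
  refine ((integrable_const (1 : ℝ)).add hi).mono' (by fun_prop) (.of_forall fun z => ?_)
  rw [Real.norm_eq_abs, abs_of_nonneg (by positivity)]
  simp only [Pi.add_apply]
  rcases le_total ‖W z‖ 1 with h | h
  · have := pow_le_one₀ (n := l) (norm_nonneg (W z)) h
    have : 0 ≤ ‖W z‖ ^ 4 := by positivity
    linarith
  · have := pow_le_pow_right₀ h hl
    linarith

variable [IsProbabilityMeasure P]

lemma integrable_abs_inner_standardize_pow
    (hi : Integrable (fun z => ‖standardize P z.1‖ ^ 4) P) {l : ℕ} (hl : l ≤ 4) (u : Vec p) :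
    Integrable (fun z => |inner ℝ u (standardize P z.1)| ^ l) P := by
  have hW := measurable_standardize (P := P)
  have hm : Measurable fun z : Vec p × ℝ => |inner ℝ u (standardize P z.1)| ^ l := by fun_prop
  refine ((integrable_norm_pow_le hW hi hl).const_mul (‖u‖ ^ l)).mono' hm.aestronglyMeasurable
    (.of_forall fun z => ?_)
  rw [Real.norm_eq_abs, abs_of_nonneg (by positivity), ← mul_pow]
  gcongr
  exact abs_real_inner_le_norm _ _

lemma integral_abs_inner_pow_le_kappa
    (hi : Integrable (fun z => ‖standardize P z.1‖ ^ 4) P) {l : ℕ} (hl : l ≤ 4) {u : Vec p}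
    (hu : ‖u‖ = 1) :
    ∫ z, |inner ℝ u (standardize P z.1)| ^ l ∂P ≤ kappa P l := by
  have hW := measurable_standardize (P := P)
  have hb : BddAbove (range fun u : Metric.sphere (0 : Vec p) 1 =>
      ∫ z, |inner ℝ (u : Vec p) (standardize P z.1)| ^ l ∂P) := by
    refine ⟨∫ z, ‖standardize P z.1‖ ^ l ∂P, ?_⟩
    rintro _ ⟨v, rfl⟩
    refine integral_mono (integrable_abs_inner_standardize_pow hi hl _)
      (integrable_norm_pow_le hW hi hl) fun z => ?_
    simp only
    gcongr
    have hv : ‖(v : Vec p)‖ = 1 := mem_sphere_zero_iff_norm.1 v.2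
    simpa [hv] using abs_real_inner_le_norm (v : Vec p) (standardize P z.1)
  exact le_ciSup hb ⟨u, mem_sphere_zero_iff_norm.2 hu⟩

lemma integral_abs_inner_pow_le_kappa_mul
    (hi : Integrable (fun z => ‖standardize P z.1‖ ^ 4) P) {l : ℕ} (hl : l ≤ 4) (hl0 : l ≠ 0)
    (u : Vec p) :
    ∫ z, |inner ℝ u (standardize P z.1)| ^ l ∂P ≤ kappa P l * ‖u‖ ^ l := by
  rcases eq_or_ne u 0 with rfl | hu0
  · simp [hl0]
  · have hn : 0 < ‖u‖ := norm_pos_iff.2 hu0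
    have h := integral_abs_inner_pow_le_kappa hi hl (u := ‖u‖⁻¹ • u)
      (by rw [norm_smul, norm_inv, norm_norm, inv_mul_cancel₀ hn.ne'])
    have e : ∀ z : Vec p × ℝ, |inner ℝ u (standardize P z.1)| ^ l
        = ‖u‖ ^ l * |inner ℝ (‖u‖⁻¹ • u) (standardize P z.1)| ^ l := fun z => by
      rw [← mul_pow, real_inner_smul_left, abs_mul, abs_of_pos (inv_pos.2 hn),
        mul_inv_cancel_left₀ hn.ne']
    simp_rw [e]
    rw [integral_const_mul, mul_comm]
    gcongr

lemma integral_inner_pow_four_le_kappa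
    (hi : Integrable (fun z => ‖standardize P z.1‖ ^ 4) P) (u : Vec p) :
    ∫ z, inner ℝ u (standardize P z.1) ^ 4 ∂P ≤ kappa P 4 * ‖u‖ ^ 4 := by
  have h := integral_abs_inner_pow_le_kappa_mul hi le_rfl (by norm_num) u
  simpa [Even.pow_abs (by decide : Even 4)] using h

/-- From $x^4\ge2x^2-1$ and isotropy. It turns the sample size condition into $p+\log(1/\delta)\le
n$. -/
lemma one_le_kappa_four (hp : 0 < p) (hpos : (secondMoment P).PosDef)
    (hi : Integrable (fun z => ‖standardize P z.1‖ ^ 4) P) : 1 ≤ kappa P 4 := by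
  have hW := measurable_standardize (P := P)
  set u : Vec p := EuclideanSpace.single ⟨0, hp⟩ (1 : ℝ)
  have hu : ‖u‖ = 1 := by simp [u]
  have h2 := integral_inner_standardize_sq hpos (integrable_norm_pow_le hW hi (by norm_num)) u
  have h4 := integral_inner_pow_four_le_kappa hi u
  have hi2 : Integrable (fun z => inner ℝ u (standardize P z.1) ^ 2) P := by
    simpa using integrable_abs_inner_standardize_pow hi (l := 2) (by norm_num) u
  have hi4 : Integrable (fun z => inner ℝ u (standardize P z.1) ^ 4) P :=
    integrable_inner_pow_four hW hi u
  have h : ∫ z, (2 * inner ℝ u (standardize P z.1) ^ 2 - 1) ∂P ≤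
      ∫ z, inner ℝ u (standardize P z.1) ^ 4 ∂P :=
    integral_mono ((hi2.const_mul 2).sub (integrable_const _)) hi4 fun z => by
      simp only
      nlinarith [sq_nonneg ((inner ℝ u (standardize P z.1) : ℝ) ^ 2 - 1)]
  rw [integral_sub (hi2.const_mul 2) (integrable_const _), integral_const_mul, h2] at h
  simp only [integral_const, probReal_univ, one_smul] at h
  rw [hu] at h h4
  linarith

/-- The weighted mean inequality $ab^2\le\frac13a^3+\frac23b^3$ reduces the mixed moment in the bias
to pure third moments. -/
lemma integral_abs_inner_mul_inner_sq_le
    (hi : Integrable (fun z => ‖standardize P z.1‖ ^ 4) P) {u v : Vec p}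
    (hu : ‖u‖ = 1) (hv : ‖v‖ ≤ 1) :
    Integrable (fun z => |inner ℝ u (standardize P z.1)| * inner ℝ v (standardize P z.1) ^ 2) P ∧
    ∫ z, |inner ℝ u (standardize P z.1)| * inner ℝ v (standardize P z.1) ^ 2 ∂P ≤ kappa P 3 := by
  have hW := measurable_standardize (P := P)
  have hiu := integrable_abs_inner_standardize_pow hi (l := 3) (by norm_num) u
  have hiv := integrable_abs_inner_standardize_pow hi (l := 3) (by norm_num) v
  have hpt : ∀ z : Vec p × ℝ,
      |inner ℝ u (standardize P z.1)| * inner ℝ v (standardize P z.1) ^ 2 ≤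
      1 / 3 * |inner ℝ u (standardize P z.1)| ^ 3 + 2 / 3 * |inner ℝ v (standardize P z.1)| ^ 3 :=
    fun z => by
      rw [← sq_abs (inner ℝ v (standardize P z.1))]
      set a := |(inner ℝ u (standardize P z.1) : ℝ)|
      set b := |(inner ℝ v (standardize P z.1) : ℝ)|
      have ha : 0 ≤ a := abs_nonneg _
      have hb : 0 ≤ b := abs_nonneg _
      nlinarith [mul_nonneg (by positivity : 0 ≤ a + 2 * b) (sq_nonneg (a - b))]
  have hsum := (hiu.const_mul (1 / 3)).add (hiv.const_mul (2 / 3))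
  have hint : Integrable
      (fun z => |inner ℝ u (standardize P z.1)| * inner ℝ v (standardize P z.1) ^ 2) P :=
    hsum.mono' (by fun_prop) (.of_forall fun z => by
      rw [Real.norm_eq_abs, abs_of_nonneg (by positivity)]; exact hpt z)
  refine ⟨hint, (integral_mono hint hsum hpt).trans ?_⟩
  simp only [Pi.add_apply]
  rw [integral_add (hiu.const_mul _) (hiv.const_mul _), integral_const_mul, integral_const_mul]
  have h1 := integral_abs_inner_pow_le_kappa hi (l := 3) (by norm_num) hu
  have h2 := integral_abs_inner_pow_le_kappa_mul hi (l := 3) (by norm_num) (by norm_num) v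
  have h0 : 0 ≤ kappa P 3 := (integral_nonneg fun z => by positivity).trans h1
  have h3 : kappa P 3 * ‖v‖ ^ 3 ≤ kappa P 3 :=
    mul_le_of_le_one_right h0 (pow_le_one₀ (norm_nonneg _) hv)
  linarith

end Kappa

end Standardization

/-! ### Quantile, shortfall and score shift for a law on the line. -/

section Line

open Filter Topology
open scoped ENNReal

variable {ν : Measure ℝ} [IsProbabilityMeasure ν] {α : ℝ}

/-- Continuity makes the infimum attained, giving $\ge$; points to the left have mass below
$\alpha$, giving $\le$ in the limit. -/
lemma real_Iic_quantile (hα0 : 0 < α) (hα1 : α < 1) (hc : Continuous fun y => ν.real (Iic y)) :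
    ν.real (Iic (quantile ν α)) = α := by
  have htop : Tendsto (fun y => ν.real (Iic y)) atTop (𝓝 1) :=
    (tendsto_cdf_atTop ν).congr (cdf_eq_real ν)
  have hbot : Tendsto (fun y => ν.real (Iic y)) atBot (𝓝 0) :=
    (tendsto_cdf_atBot ν).congr (cdf_eq_real ν)
  have hne : {y : ℝ | α ≤ ν.real (Iic y)}.Nonempty := by
    obtain ⟨y, hy⟩ := (htop.eventually (lt_mem_nhds hα1)).exists
    exact ⟨y, hy.le⟩
  have hbdd : BddBelow {y : ℝ | α ≤ ν.real (Iic y)} := by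
    obtain ⟨y, hy⟩ := (hbot.eventually (gt_mem_nhds hα0)).exists
    refine ⟨y, fun w hw => ?_⟩
    rw [mem_ofPred_eq] at hw
    by_contra! hlt
    have : ν.real (Iic w) ≤ ν.real (Iic y) := measureReal_mono (Iic_subset_Iic.2 hlt.le)
    linarith
  have hcl : IsClosed {y : ℝ | α ≤ ν.real (Iic y)} := isClosed_le continuous_const hc
  refine le_antisymm ?_ (hcl.csInf_mem hne hbdd)
  refine le_of_tendsto (hc.continuousWithinAt (s := Iio (quantile ν α)) (x := quantile ν α)) ?_
  filter_upwards [self_mem_nhdsWithin] with y hy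
  by_contra! hlt
  exact (notMem_of_lt_csInf hy hbdd) hlt.le

/-- Identifies the conditional mean of $\varepsilon_-$ as $\alpha X^T(\theta^*-\beta^*)$, the
centring used in `centeredShortfall`. -/
lemma integral_min_sub_eq {q : ℝ} (hα0 : 0 < α) (hq : ν.real (Iic q) = α)
    (hi : IntegrableOn (fun y : ℝ => y) (Iic q) ν) :
    ∫ y, min (y - q) 0 ∂ν = α * (∫ y, y ∂(ν[|Iic q]) - q) := by
  have h1 : (fun y : ℝ => min (y - q) 0) = (Iic q).indicator fun y => y - q := by
    ext y
    by_cases hy : y ∈ Iic q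
    · rw [indicator_of_mem hy, min_eq_left (by rw [mem_Iic] at hy; linarith)]
    · rw [indicator_of_notMem hy, min_eq_right (by rw [mem_Iic] at hy; linarith)]
  rw [h1, integral_indicator measurableSet_Iic, integral_sub hi (integrable_const _),
    ProbabilityTheory.cond, integral_smul_measure, setIntegral_const, hq, ENNReal.toReal_inv]
  change _ = α * ((ν.real (Iic q))⁻¹ • _ - q)
  rw [hq, smul_eq_mul, smul_eq_mul]
  field_simp

/-- The change of the expected-shortfall score when the quantile is shifted by `s`, at
residual `e`. -/
def scoreShift (α s e : ℝ) : ℝ := α * s - (max (s - e) 0 - max (-e) 0)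

lemma abs_scoreShift_sub_le (hα0 : 0 < α) (hα1 : α < 1) (s t e : ℝ) :
    |scoreShift α s e - scoreShift α t e| ≤ |s - t| := by
  wlog h : t ≤ s generalizing s t
  · rw [abs_sub_comm, abs_sub_comm s]
    exact this t s (le_of_not_ge h)
  have h1 : max (t - e) 0 ≤ max (s - e) 0 := max_le_max (by linarith) le_rfl
  have h2 : max (s - e) 0 ≤ max (t - e) 0 + (s - t) :=
    max_le (by linarith [le_max_left (t - e) 0]) (by linarith [le_max_right (t - e) 0])
  have h3 : α * (s - t) ≤ s - t := mul_le_of_le_one_left (by linarith) hα1.le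
  have h4 : 0 ≤ α * (s - t) := mul_nonneg hα0.le (by linarith)
  rw [abs_of_nonneg (by linarith : (0 : ℝ) ≤ s - t), abs_le, scoreShift, scoreShift]
  constructor <;> linarith

/-- Away from $t=e$, the positive part $(t-e)_+$ has derivative $1(e\le t)$; one exceptional point
does no harm. -/
lemma scoreShift_eq_intervalIntegral (s e : ℝ) :
    scoreShift α s e = ∫ t in (0 : ℝ)..s, (α - (Ici e).indicator (fun _ => (1 : ℝ)) t) := by
  have hint : IntervalIntegrable ((Ici e).indicator fun _ => (1 : ℝ)) volume 0 s := by
    rw [intervalIntegrable_iff]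
    exact (intervalIntegrable_iff.1 intervalIntegrable_const).indicator measurableSet_Ici
  have h := integral_eq_of_hasDerivAt_off_countable (fun t => max (t - e) 0)
    ((Ici e).indicator fun _ => (1 : ℝ)) (a := 0) (b := s) (countable_singleton e)
    (by fun_prop) (fun x hx => ?_) hint
  · rw [intervalIntegral.integral_sub intervalIntegrable_const hint, h,
      intervalIntegral.integral_const, scoreShift]
    simp [mul_comm]
  · have hxe : x ≠ e := hx.2
    rcases lt_or_gt_of_ne hxe with hlt | hgt
    · rw [indicator_of_notMem (by simpa using hlt)]
      refine (hasDerivAt_const x (0 : ℝ)).congr_of_eventuallyEq ?_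
      filter_upwards [gt_mem_nhds hlt] with y hy
      exact max_eq_right (by linarith)
    · rw [indicator_of_mem (by simpa using hgt.le)]
      refine ((hasDerivAt_id x).sub_const e).congr_of_eventuallyEq ?_
      filter_upwards [lt_mem_nhds hgt] with y hy
      exact max_eq_left (by linarith)

lemma abs_intervalIntegral_abs (s : ℝ) : abs (∫ t in (0 : ℝ)..s, |t|) = s ^ 2 / 2 := by
  have hpos : ∀ s : ℝ, 0 ≤ s → ∫ t in (0 : ℝ)..s, |t| = s ^ 2 / 2 := fun s hs => by
    rw [intervalIntegral.integral_congr (g := fun t => t), integral_id]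
    · ring
    · intro t ht
      rw [uIcc_of_le hs] at ht
      exact abs_of_nonneg ht.1
  rcases le_total 0 s with hs | hs
  · rw [hpos s hs, abs_of_nonneg (by positivity)]
  · have h := intervalIntegral.integral_comp_neg (a := 0) (b := s) (fun t : ℝ => |t|)
    simp only [abs_neg, neg_zero] at h
    rw [h, intervalIntegral.integral_symm, hpos (-s) (by linarith), abs_neg, neg_sq,
      abs_of_nonneg (by positivity)]

/-- Orthogonality of the score: by Fubini the mean is $\int_0^s(\alpha-F(t))\,dt$, whose integrand
is at most $\bar f|t|$ because $F(0)=\alpha$. -/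
lemma abs_integral_scoreShift_le {q fbar : ℝ}
    (hF : ∀ t, |ν.real {y | y - q ≤ t} - α| ≤ fbar * |t|) (s : ℝ) :
    |∫ y, scoreShift α s (y - q) ∂ν| ≤ fbar * (s ^ 2 / 2) := by
  have hm : Measurable (Function.uncurry fun (t y : ℝ) =>
      α - (Ici (y - q)).indicator (fun _ => (1 : ℝ)) t) := by
    have e : (Function.uncurry fun (t y : ℝ) =>
        α - (Ici (y - q)).indicator (fun _ => (1 : ℝ)) t)
        = fun r : ℝ × ℝ => α - {r : ℝ × ℝ | r.2 - q ≤ r.1}.indicator (fun _ => (1 : ℝ)) r := by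
      ext r; rfl
    rw [e]
    exact measurable_const.sub
      (measurable_const.indicator (measurableSet_le (by fun_prop) (by fun_prop)))
  have hfin : IsFiniteMeasure (volume.restrict (uIoc 0 s)) := by
    rw [uIoc]; infer_instance
  have hint : Integrable (Function.uncurry fun (t y : ℝ) =>
      α - (Ici (y - q)).indicator (fun _ => (1 : ℝ)) t) ((volume.restrict (uIoc 0 s)).prod ν) := by
    refine (integrable_const (|α| + 1)).mono' hm.aestronglyMeasurable (.of_forall fun r => ?_)
    refine (norm_sub_le _ _).trans ?_
    rw [Real.norm_eq_abs]
    gcongr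
    refine (norm_indicator_le_norm_self _ _).trans ?_
    simp
  have hinner : ∀ t : ℝ, ∫ y, (α - (Ici (y - q)).indicator (fun _ => (1 : ℝ)) t) ∂ν
      = α - ν.real {y | y - q ≤ t} := fun t => by
    have e : (fun y : ℝ => (Ici (y - q)).indicator (fun _ => (1 : ℝ)) t)
        = {y | y - q ≤ t}.indicator fun _ => (1 : ℝ) := by
      ext r; rfl
    have hms : MeasurableSet {y : ℝ | y - q ≤ t} := measurableSet_le (by fun_prop) (by fun_prop)
    rw [integral_sub (integrable_const _), e, integral_indicator hms]
    · simp
    · rw [e]; exact (integrable_const _).indicator hms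
  simp_rw [scoreShift_eq_intervalIntegral]
  rw [← intervalIntegral_integral_swap hint]
  simp_rw [hinner]
  rw [← Real.norm_eq_abs]
  refine (intervalIntegral.norm_integral_le_abs_of_norm_le (g := fun t => fbar * |t|)
    (.of_forall fun t => ?_) ?_).trans ?_
  · rw [Real.norm_eq_abs, abs_sub_comm]; exact hF t
  · exact (by fun_prop : Continuous fun t : ℝ => fbar * |t|).intervalIntegrable _ _
  · have h0 : 0 ≤ fbar := by
      have := (abs_nonneg _).trans (hF 1)
      simpa using this
    rw [intervalIntegral.integral_const_mul, abs_mul, abs_of_nonneg h0, abs_intervalIntegral_abs]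

end Line

/-! ### Noise and bias, conditionally on the covariates. -/

section Conditional

open Filter Topology
open scoped ENNReal

variable {p : ℕ} {P : Measure (Vec p × ℝ)} [IsProbabilityMeasure P] {α fbar σbar : ℝ}
  {βs θs : Vec p}

lemma residualCDF_eq (x : Vec p) (t : ℝ) :
    residualCDF P βs x t = (P.condKernel x).real (Iic (t + inner ℝ x βs)) := by
  rw [residualCDF]
  congr 1
  ext y
  simp

/-- The truncated residual, centered at its conditional mean. -/
def centeredShortfall (α : ℝ) (βs θs : Vec p) (z : Vec p × ℝ) : ℝ :=
  min (z.2 - inner ℝ z.1 βs) 0 - α * (inner ℝ z.1 θs - inner ℝ z.1 βs)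

lemma measurable_centeredShortfall : Measurable (centeredShortfall α βs θs) := by
  unfold centeredShortfall; fun_prop

lemma residualCDF_zero_ae (hα0 : 0 < α) (hα1 : α < 1) (hM : JointModel P α βs θs)
    (hD : DensityCondition P βs fbar σbar) :
    ∀ᵐ x ∂P.fst, residualCDF P βs x 0 = α := by
  filter_upwards [hM, hD] with x hx hd
  rw [residualCDF_eq, zero_add, ← hx.1]
  refine real_Iic_quantile hα0 hα1 ?_
  have h := hd.1.continuous.comp (continuous_sub_right (inner ℝ x βs))
  refine h.congr fun y => ?_
  simp [residualCDF_eq]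

lemma abs_residualCDF_sub_le_ae (hα0 : 0 < α) (hα1 : α < 1) (hM : JointModel P α βs θs)
    (hD : DensityCondition P βs fbar σbar) :
    ∀ᵐ x ∂P.fst, ∀ t : ℝ,
      |(P.condKernel x).real {y | y - inner ℝ x βs ≤ t} - α| ≤ fbar * |t| := by
  filter_upwards [hD, residualCDF_zero_ae hα0 hα1 hM hD] with x hd h0 t
  have := hd.2.1 t
  rwa [h0] at this

lemma centeredShortfall_ae (hα0 : 0 < α) (hα1 : α < 1) (hM : JointModel P α βs θs)
    (hD : DensityCondition P βs fbar σbar) :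
    ∀ᵐ x ∂P.fst, ∫ y, centeredShortfall α βs θs (x, y) ∂P.condKernel x = 0 ∧
      ∫⁻ y, ENNReal.ofReal (centeredShortfall α βs θs (x, y) ^ 2) ∂P.condKernel x
        ≤ ENNReal.ofReal (σbar ^ 2) := by
  filter_upwards [hM, hD, residualCDF_zero_ae hα0 hα1 hM hD] with x hx hd h0
  obtain ⟨hq, hi, hES⟩ := hx
  obtain ⟨-, -, hL, hV⟩ := hd
  rw [residualCDF_eq, zero_add] at h0
  rw [expectedShortfall, hq] at hES
  rw [hq] at hi
  have hmean := integral_min_sub_eq hα0 h0 hi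
  rw [hES] at hmean
  have hLi := hL.integrable one_le_two
  refine ⟨?_, ?_⟩
  · simp only [centeredShortfall]
    rw [integral_sub hLi (integrable_const _), hmean]
    simp
  · have hsq : Integrable (fun y => centeredShortfall α βs θs (x, y) ^ 2) (P.condKernel x) := by
      have h : MemLp (fun y : ℝ => min (y - inner ℝ x βs) 0
          - α * (inner ℝ x θs - inner ℝ x βs)) 2 (P.condKernel x) := hL.sub (memLp_const _)
      exact h.integrable_sq
    rw [← ofReal_integral_eq_lintegral_ofReal hsq (.of_forall fun y => sq_nonneg _)]
    refine ENNReal.ofReal_le_ofReal (le_trans (le_of_eq ?_) hV)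
    rw [variance_eq_integral hL.aestronglyMeasurable.aemeasurable, hmean]
    rfl

/-- $W$ is fixed given $X$, so the conditional variance bound factors out. Stated with lower
integrals, it yields the square integrability of the noise vector afterwards. -/
lemma lintegral_norm_sq_centeredShortfall_le {W : Vec p → Vec p} (hW : Measurable W)
    (hα0 : 0 < α) (hα1 : α < 1) (hM : JointModel P α βs θs)
    (hD : DensityCondition P βs fbar σbar) :
    ∫⁻ z, ENNReal.ofReal (‖centeredShortfall α βs θs z • W z.1‖ ^ 2) ∂P ≤
      ENNReal.ofReal (σbar ^ 2) * ∫⁻ z, ENNReal.ofReal (‖W z.1‖ ^ 2) ∂P := by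
  have hW' : Measurable fun z : Vec p × ℝ => W z.1 := hW.comp measurable_fst
  have hm := measurable_centeredShortfall (α := α) (βs := βs) (θs := θs)
  have hm1 : ∀ x, Measurable fun y => centeredShortfall α βs θs (x, y) := fun x =>
    hm.comp measurable_prodMk_left
  rw [← Measure.lintegral_condKernel
      (f := fun z => ENNReal.ofReal (‖centeredShortfall α βs θs z • W z.1‖ ^ 2)) (by fun_prop),
    ← Measure.lintegral_condKernel (f := fun z => ENNReal.ofReal (‖W z.1‖ ^ 2)) (by fun_prop),
    ← lintegral_const_mul' _ _ ENNReal.ofReal_ne_top]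
  refine lintegral_mono_ae ?_
  filter_upwards [centeredShortfall_ae hα0 hα1 hM hD] with x hx
  simp_rw [norm_smul, mul_pow, Real.norm_eq_abs, sq_abs,
    ENNReal.ofReal_mul (sq_nonneg (centeredShortfall α βs θs (x, _)))]
  have := hm1 x
  rw [lintegral_mul_const _ (by fun_prop)]
  simp only [lintegral_const, measure_univ, mul_one]
  gcongr
  exact hx.2

lemma memLp_centeredShortfall_smul {W : Vec p → Vec p} (hW : Measurable W)
    (hWi : Integrable (fun z => ‖W z.1‖ ^ 2) P)
    (hα0 : 0 < α) (hα1 : α < 1) (hM : JointModel P α βs θs)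
    (hD : DensityCondition P βs fbar σbar) :
    MemLp (fun z => centeredShortfall α βs θs z • W z.1) 2 P ∧
    ∫ z, centeredShortfall α βs θs z • W z.1 ∂P = 0 ∧
    ∫ z, ‖centeredShortfall α βs θs z • W z.1‖ ^ 2 ∂P ≤ σbar ^ 2 * ∫ z, ‖W z.1‖ ^ 2 ∂P := by
  have hm := measurable_centeredShortfall (α := α) (βs := βs) (θs := θs)
  have hm' : Measurable fun z : Vec p × ℝ => centeredShortfall α βs θs z • W z.1 := by fun_prop
  have hle := lintegral_norm_sq_centeredShortfall_le hW hα0 hα1 hM hD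
  rw [← ofReal_integral_eq_lintegral_ofReal hWi (.of_forall fun z => by positivity),
    ← ENNReal.ofReal_mul (sq_nonneg _)] at hle
  have hsq : Integrable (fun z => ‖centeredShortfall α βs θs z • W z.1‖ ^ 2) P :=
    (lintegral_ofReal_ne_top_iff_integrable (by fun_prop) (.of_forall fun z => by positivity)).1
      (hle.trans_lt ENNReal.ofReal_lt_top).ne
  have hL : MemLp (fun z => centeredShortfall α βs θs z • W z.1) 2 P :=
    (memLp_two_iff_integrable_sq_norm hm'.aestronglyMeasurable).2 hsq
  refine ⟨hL, ?_, ?_⟩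
  · rw [← Measure.integral_condKernel (hL.integrable one_le_two)]
    refine integral_eq_zero_of_ae ?_
    filter_upwards [centeredShortfall_ae hα0 hα1 hM hD] with x hx
    simp only
    rw [integral_smul_const, hx.1, zero_smul, Pi.zero_apply]
  · rwa [← ofReal_integral_eq_lintegral_ofReal hsq (.of_forall fun z => by positivity),
      ENNReal.ofReal_le_ofReal_iff
        (mul_nonneg (sq_nonneg _) (integral_nonneg fun z => by positivity))] at hle

/-- The shift of the score on the scale `r₀`, as a multiplier. -/
def scaledShift (α r₀ : ℝ) (βs : Vec p) (z : Vec p × ℝ) (s : ℝ) : ℝ :=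
  scoreShift α (r₀ * s) (z.2 - inner ℝ z.1 βs) / r₀

lemma measurable_scaledShift (α r₀ : ℝ) (βs : Vec p) :
    Measurable fun q : (Vec p × ℝ) × ℝ => scaledShift α r₀ βs q.1 q.2 := by
  unfold scaledShift scoreShift; fun_prop

lemma abs_scaledShift_sub_le (hα0 : 0 < α) (hα1 : α < 1) {r₀ : ℝ} (hr : 0 < r₀)
    (z : Vec p × ℝ) (s t : ℝ) :
    |scaledShift α r₀ βs z s - scaledShift α r₀ βs z t| ≤ |s - t| := by
  rw [scaledShift, scaledShift, ← sub_div, abs_div, abs_of_pos hr, div_le_iff₀ hr]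
  refine (abs_scoreShift_sub_le hα0 hα1 _ _ _).trans_eq ?_
  rw [← mul_sub, abs_mul, abs_of_pos hr, mul_comm]

lemma scaledShift_zero (r₀ : ℝ) (z : Vec p × ℝ) : scaledShift α r₀ βs z 0 = 0 := by
  simp [scaledShift, scoreShift]

/-- Given $X=x$ the shift is $s=r_0v^TW$, and the quadratic bias bound divided by $r_0$ leaves
$\frac12\bar fr_0(v^TW)^2$. -/
lemma abs_inner_integral_multSummand_le {W : Vec p → Vec p} (hW : Measurable W)
    (hWi : Integrable (fun z => ‖W z.1‖ ^ 2) P) (hα0 : 0 < α) (hα1 : α < 1)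
    (hM : JointModel P α βs θs) (hD : DensityCondition P βs fbar σbar) {r₀ : ℝ} (hr : 0 < r₀)
    (u v : Vec p)
    (hi : Integrable (fun z => |inner ℝ u (W z.1)| * inner ℝ v (W z.1) ^ 2) P) :
    |inner ℝ u (∫ z, multSummand (fun z : Vec p × ℝ => W z.1) (scaledShift α r₀ βs) z v ∂P)| ≤
      fbar * r₀ / 2 * ∫ z, |inner ℝ u (W z.1)| * inner ℝ v (W z.1) ^ 2 ∂P := by
  have hmi := integrable_multSummand (P := P) (W := fun z : Vec p × ℝ => W z.1) (by fun_prop)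
    (measurable_scaledShift α r₀ βs) (abs_scaledShift_sub_le hα0 hα1 hr)
    (scaledShift_zero r₀) hWi v
  rw [← integral_inner hmi, ← Measure.integral_condKernel (hmi.const_inner u),
    ← integral_const_mul, ← Measure.integral_condKernel (hi.const_mul _), ← Real.norm_eq_abs]
  refine norm_integral_le_of_norm_le ?_ ?_
  · simpa using (hi.const_mul (fbar * r₀ / 2)).integral_condKernel
  · filter_upwards [abs_residualCDF_sub_le_ae hα0 hα1 hM hD] with x hx
    have h := abs_integral_scoreShift_le hx (r₀ * inner ℝ v (W x))
    have e : ∫ y, inner ℝ u (multSummand (fun z : Vec p × ℝ => W z.1) (scaledShift α r₀ βs)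
        (x, y) v) ∂P.condKernel x = (∫ y, scoreShift α (r₀ * inner ℝ v (W x))
          (y - inner ℝ x βs) ∂P.condKernel x) / r₀ * inner ℝ u (W x) := by
      rw [← integral_div, ← integral_mul_const]
      refine integral_congr_ae (.of_forall fun y => ?_)
      simp only [multSummand, scaledShift, real_inner_smul_right]
    rw [e, Real.norm_eq_abs, abs_mul, abs_div, abs_of_pos hr]
    simp only [integral_const, probReal_univ, one_smul]
    calc _ ≤ (fbar * ((r₀ * inner ℝ v (W x)) ^ 2 / 2)) / r₀ * |inner ℝ u (W x)| := by gcongr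
      _ = _ := by field_simp

end Conditional

/-! ### Score decomposition and first-order condition. -/

section NormalEquation

variable {n p : ℕ} {α r₀ : ℝ} {βs θs : Vec p}

lemma sum_mul_eq_zero_of_min {ι : Type*} [Fintype ι] {a c : ι → ℝ}
    (h : ∀ t : ℝ, ∑ i, a i ^ 2 ≤ ∑ i, (a i + t * c i) ^ 2) : ∑ i, a i * c i = 0 := by
  have h1 : ∀ t : ℝ, 0 ≤ t * (2 * ∑ i, a i * c i) + t ^ 2 * ∑ i, c i ^ 2 := fun t => by
    have e : ∑ i, (a i + t * c i) ^ 2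
        = ∑ i, a i ^ 2 + (t * (2 * ∑ i, a i * c i) + t ^ 2 * ∑ i, c i ^ 2) := by
      simp only [Finset.mul_sum, ← Finset.sum_add_distrib]
      exact Finset.sum_congr rfl fun i _ => by ring
    linarith [h t]
  set A := ∑ i, a i * c i
  set C := ∑ i, c i ^ 2 with hC
  have hC0 : 0 ≤ C := Finset.sum_nonneg fun i _ => sq_nonneg _
  by_contra hA
  -- The $+1$ keeps the step defined when $C=0$.
  have h2 := h1 (-A / (C + 1))
  have e : -A / (C + 1) * (2 * A) + (-A / (C + 1)) ^ 2 * C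
      = -(A ^ 2 * (C + 2) / (C + 1) ^ 2) := by field_simp; ring
  rw [e] at h2
  have : 0 < A ^ 2 * (C + 2) / (C + 1) ^ 2 := by positivity
  linarith

/-- Since $1(y\le b)(b-y)=(b-y)_+$, the indicators in the score collapse to a continuous function of
$\beta$, which is what makes the shift Lipschitz. -/
lemma score_eq (hr : r₀ ≠ 0) (β θ : Vec p) (z : Vec p × ℝ) :
    score α β θ z = α * inner ℝ z.1 (θ - θs) - (centeredShortfall α βs θs z +
      r₀ * scaledShift α r₀ βs z (inner ℝ z.1 (β - βs) / r₀)) := by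
  have e1 : r₀ * scaledShift α r₀ βs z (inner ℝ z.1 (β - βs) / r₀)
      = scoreShift α (inner ℝ z.1 (β - βs)) (z.2 - inner ℝ z.1 βs) := by
    rw [scaledShift]; field_simp
  rw [e1, score, centeredShortfall, scoreShift, inner_sub_right, inner_sub_right]
  set a : ℝ := inner ℝ z.1 θ
  set b : ℝ := inner ℝ z.1 β
  set bs : ℝ := inner ℝ z.1 βs
  have h1 : min (z.2 - bs) 0 = - max (-(z.2 - bs)) 0 := by
    rw [← min_neg_neg, neg_neg, neg_zero]
  have h2 : (if z.2 ≤ b then (1 : ℝ) else 0) * (b - z.2) = max (b - bs - (z.2 - bs)) 0 := by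
    split_ifs with h
    · rw [max_eq_left (by linarith)]; ring
    · rw [max_eq_right (by linarith)]; ring
  rw [h1, ← h2]
  ring

lemma score_add (β θ d : Vec p) (t : ℝ) (z : Vec p × ℝ) :
    score α β (θ + t • d) z = score α β θ z + t * (α * inner ℝ z.1 d) := by
  rw [score, score, inner_add_right, real_inner_smul_right]; ring

lemma sum_score_mul_eq_zero (hn : 0 < n) {z : Fin n → Vec p × ℝ} {β θ : Vec p}
    (h : IsMinOn (esLoss α z β) univ θ) (d : Vec p) :
    ∑ i, score α β θ (z i) * (α * inner ℝ (z i).1 d) = 0 := by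
  refine sum_mul_eq_zero_of_min fun t => ?_
  have h1 := isMinOn_univ_iff.1 h (θ + t • d)
  simp only [esLoss, score_add] at h1
  have hn' : (0 : ℝ) < 1 / n := by positivity
  exact le_of_mul_le_mul_left h1 hn'

end NormalEquation

/-! ### Deterministic error bound. -/

section ErrorBound

variable {n p : ℕ} {P : Measure (Vec p × ℝ)} {α r₀ : ℝ} {βs θs : Vec p}

/-- The deterministic part of the error bound for the second-step estimator. -/
lemma mul_matNorm_le (hn : 0 < n) (hα0 : 0 < α) (hr : 0 < r₀) (hpos : (secondMoment P).PosDef)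
    {z : Fin n → Vec p × ℝ} {βh θh : Vec p} (hest : IsTwoStepEstimate α z βh θh)
    (hβ : matNorm (secondMoment P) (βh - βs) ≤ r₀) {a b c : ℝ} (ha : 0 ≤ a) (hc : 0 ≤ c)
    (hlow : ∀ u : Vec p, ‖u‖ = 1 → (n : ℝ) / 2 ≤ ∑ i, inner ℝ u (standardize P (z i).1) ^ 2)
    (hnoise : ‖∑ i, centeredShortfall α βs θs (z i) • standardize P (z i).1‖ ≤ a)
    {m : Vec p → Vec p}
    (hproc : ∀ v : Vec p, ‖v‖ ≤ 1 → ‖∑ i, multSummand (fun z : Vec p × ℝ => standardize P z.1)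
      (scaledShift α r₀ βs) (z i) v - (n : ℝ) • m v‖ ≤ b)
    (hbias : ∀ u v : Vec p, ‖u‖ = 1 → ‖v‖ ≤ 1 → |inner ℝ u (m v)| ≤ c) :
    α * matNorm (secondMoment P) (θh - θs) ≤ 2 / n * a + 2 * r₀ * c + 2 / n * r₀ * b := by
  have hn' : (0 : ℝ) < n := by exact_mod_cast hn
  set R := CFC.sqrt (secondMoment P)
  set W : Vec p × ℝ → Vec p := fun z => standardize P z.1 with hW
  set η := mulVecE R (θh - θs) with hη
  set v := r₀⁻¹ • mulVecE R (βh - βs) with hv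
  have hv1 : ‖v‖ ≤ 1 := by
    rw [hv, norm_smul, Real.norm_eq_abs, abs_of_pos (inv_pos.2 hr), inv_mul_le_iff₀ hr, mul_one]
    exact hβ
  have hb : 0 ≤ b := (norm_nonneg _).trans (hproc v hv1)
  have hgoal : α * ‖η‖ ≤ 2 / n * a + 2 * r₀ * c + 2 / n * r₀ * b := by
    rcases eq_or_ne η 0 with h0 | h0
    · rw [h0, norm_zero, mul_zero]; positivity
    have hηn : 0 < ‖η‖ := norm_pos_iff.2 h0
    set u := ‖η‖⁻¹ • η with hu
    have hu1 : ‖u‖ = 1 := by rw [hu, norm_smul, norm_inv, norm_norm, inv_mul_cancel₀ hηn.ne']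
    have hηu : η = ‖η‖ • u := by rw [hu, smul_inv_smul₀ hηn.ne']
    have hnormal := sum_score_mul_eq_zero hn hest.2 (θh - θs)
    have hx : ∀ i, (inner ℝ (z i).1 (θh - θs) : ℝ) = ‖η‖ * inner ℝ u (W (z i)) := fun i => by
      rw [inner_eq_inner_standardize hpos, ← hη]
      conv_lhs => rw [hηu, real_inner_smul_left]
    have hxv : ∀ i, (inner ℝ (z i).1 (βh - βs) : ℝ) / r₀ = inner ℝ v (W (z i)) := fun i => by
      rw [inner_eq_inner_standardize hpos, hv, real_inner_smul_left, div_eq_inv_mul]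
    simp_rw [score_eq (θs := θs) (βs := βs) hr.ne', hx, hxv] at hnormal
    -- The normal equation in the direction $\hat\theta-\theta^*$, rewritten in $W$; the common
    -- factor $\alpha\|\eta\|>0$ is cancelled next.
    have hsum : (α * ‖η‖) * (α * ‖η‖ * ∑ i, inner ℝ u (W (z i)) ^ 2) =
        (α * ‖η‖) * (inner ℝ u (∑ i, centeredShortfall α βs θs (z i) • W (z i))
          + r₀ * inner ℝ u (∑ i, multSummand W (scaledShift α r₀ βs) (z i) v)) := by
      rw [inner_sum, inner_sum, Finset.mul_sum, Finset.mul_sum, Finset.mul_sum,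
        ← Finset.sum_add_distrib, Finset.mul_sum, ← sub_eq_zero, ← Finset.sum_sub_distrib,
        ← hnormal]
      refine Finset.sum_congr rfl fun i _ => ?_
      rw [multSummand, real_inner_smul_right, real_inner_smul_right]
      ring
    have hsum' := mul_left_cancel₀ (mul_pos hα0 hηn).ne' hsum
    have h1 : inner ℝ u (∑ i, centeredShortfall α βs θs (z i) • W (z i)) ≤ a := by
      refine (real_inner_le_norm _ _).trans ?_
      rw [hu1, one_mul]; exact hnoise
    have h2 : inner ℝ u (∑ i, multSummand W (scaledShift α r₀ βs) (z i) v) ≤ b + n * c := by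
      have h3 := (real_inner_le_norm u _).trans
        ((mul_le_mul_of_nonneg_left (hproc v hv1) (norm_nonneg u)))
      rw [hu1, one_mul, inner_sub_right, real_inner_smul_right] at h3
      have h4 := mul_le_mul_of_nonneg_left ((le_abs_self _).trans (hbias u v hu1 hv1)) hn'.le
      linarith
    have h5 : α * ‖η‖ * (n / 2) ≤ a + r₀ * (b + n * c) := by
      calc _ ≤ α * ‖η‖ * ∑ i, inner ℝ u (W (z i)) ^ 2 := by
            have := hlow u hu1
            gcongr
        _ = _ := hsum'
        _ ≤ _ := by gcongr
    have e : 2 / n * a + 2 * r₀ * c + 2 / n * r₀ * b = (a + r₀ * (b + n * c)) / (n / 2) := by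
      field_simp
      ring
    rw [e, le_div_iff₀ (by positivity)]
    exact h5
  exact hgoal

end ErrorBound

end ESReg

end

/-! ### Assembly of the three good events. -/

theorem theorem4p1 :
    ∃ C₁ C₂ : ℝ, 0 < C₁ ∧ 0 < C₂ ∧
      ∀ (n p : ℕ) (α : ℝ) (_ : 0 < α) (_ : α < 1)
        -- the joint law of the covariates and the response, and the true parameters
        (P : Measure (ESReg.Vec p × ℝ)) [IsProbabilityMeasure P] (βs θs : ESReg.Vec p)
        (fbar σbar υ₁ : ℝ) (_ : 0 ≤ σbar)
        (_ : ESReg.JointModel P α βs θs)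
        (_ : ESReg.DensityCondition P βs fbar σbar)
        (_ : ESReg.SubGaussianCovariates P υ₁)
        -- an i.i.d. sample from this law
        (Ω : Type*) [MeasurableSpace Ω] (μ : Measure Ω) [IsProbabilityMeasure μ]
        (Z : Fin n → Ω → ESReg.Vec p × ℝ) (_ : iIndepFun Z μ) (_ : ∀ i, HasLaw (Z i) P μ)
        -- the two-step estimators
        (βh θh : Ω → ESReg.Vec p)
        (_ : ∀ᵐ ω ∂μ, ESReg.IsTwoStepEstimate α (fun i => Z i ω) (βh ω) (θh ω))
        (r₀ δ : ℝ) (_ : 0 < r₀) (_ : 0 < δ) (_ : δ ≤ 1 / 3)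
        (_ : C₂ * ESReg.kappa P 4 * (p + 2 * Real.log (2 / δ)) ≤ n),
        -- up to probability `3δ`, the bound holds whenever `βh` lies in the `r₀`-ball around `βs`
        μ {ω | ESReg.matNorm (ESReg.secondMoment P) (βh ω - βs) ≤ r₀ ∧
            ¬ α * ESReg.matNorm (ESReg.secondMoment P) (θh ω - θs) ≤
              2 * σbar * √(p / (n * δ)) + fbar * ESReg.kappa P 3 * r₀ ^ 2 +
                C₁ * υ₁ ^ 2 * √((p + Real.log (1 / δ)) / n) * r₀}
          ≤ ENNReal.ofReal (3 * δ) := by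
  -- $4640=2\cdot2320$, the 2 coming from the curvature bound $n/2$; 544 is the constant of the
  -- eigenvalue bound.
  refine ⟨4640, 544, by norm_num, by norm_num, ?_⟩
  intro n p α hα0 hα1 P _ βs θs fbar σbar υ hσ hM hD hS Ω _ μ _ Z hind hlaw βh θh hest r₀ δ hr hδ
    hδ1 hn
  obtain ⟨hυ1, hpos, htail⟩ := hS
  have hυ : 0 < υ := one_pos.trans_le hυ1
  -- For $p=0$ there are no unit vectors and $\kappa_3$ is a supremum over the empty set, which is 0
  -- by convention; the error vanishes as well.
  rcases Nat.eq_zero_or_pos p with rfl | hp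
  · have hκ : ESReg.kappa P 3 = 0 := by
      have : IsEmpty (Metric.sphere (0 : ESReg.Vec 0) 1) := by
        refine ⟨fun u => ?_⟩
        have h1 : ‖(u : ESReg.Vec 0)‖ = 1 := mem_sphere_zero_iff_norm.1 u.2
        rw [Subsingleton.elim (u : ESReg.Vec 0) 0, norm_zero] at h1
        exact zero_ne_one h1
      rw [ESReg.kappa, Real.iSup_of_isEmpty]
    refine le_of_eq_of_le (measure_mono_null ?_ (measure_empty (μ := μ))) zero_le
    rintro ω ⟨-, hω⟩
    refine hω ?_
    have h0 : ESReg.matNorm (ESReg.secondMoment P) (θh ω - θs) = 0 := by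
      rw [ESReg.matNorm, norm_eq_zero]
      exact Subsingleton.elim _ _
    rw [h0, hκ]
    simp only [mul_zero, zero_mul, add_zero]
    positivity
  set W : ESReg.Vec p × ℝ → ESReg.Vec p := fun z => ESReg.standardize P z.1 with hW
  have hWm : Measurable W := ESReg.measurable_standardize
  have hsg : ∀ u : ESReg.Vec p, ‖u‖ ≤ 1 → ∫⁻ z, ENNReal.ofReal
      (Real.exp (inner ℝ u (W z) ^ 2 / (4 * υ ^ 2))) ∂P ≤ ENNReal.ofReal 3 :=
    fun u hu => ESReg.lintegral_exp_inner_sq_le hWm hυ htail hu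
  have hi4 : Integrable (fun z => ‖W z‖ ^ 4) P :=
    ESReg.integrable_norm_pow_four_of_subGaussian hWm hυ hsg
  have hi2 : Integrable (fun z => ‖W z‖ ^ 2) P := ESReg.integrable_norm_pow_le hWm hi4 (by norm_num)
  have hiso : ∀ u : ESReg.Vec p, ∫ z, inner ℝ u (W z) ^ 2 ∂P = ‖u‖ ^ 2 :=
    ESReg.integral_inner_standardize_sq hpos hi2
  have hk1 : 1 ≤ ESReg.kappa P 4 := ESReg.one_le_kappa_four hp hpos hi4
  have hk0 : 0 < ESReg.kappa P 4 := one_pos.trans_le hk1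
  have htr : ∫ z, ‖W z‖ ^ 2 ∂P = p := by
    simp_rw [ESReg.norm_sq_eq_sum_inner]
    rw [integral_finsetSum _ fun j _ => by
      simpa using ESReg.integrable_abs_inner_standardize_pow hi4 (l := 2) (by norm_num)
        (EuclideanSpace.single j (1 : ℝ))]
    simp_rw [hiso]
    simp
  have hlog : 0 ≤ Real.log (1 / δ) := Real.log_nonneg (by rw [le_div_iff₀ hδ]; linarith)
  have hlog2 : Real.log (1 / δ) ≤ 2 * Real.log (2 / δ) := by
    have : Real.log (1 / δ) ≤ Real.log (2 / δ) :=
      Real.log_le_log (by positivity) (by gcongr; norm_num)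
    linarith
  have hn1 : 544 * ESReg.kappa P 4 * (p + Real.log (1 / δ)) ≤ n := by
    refine le_trans ?_ hn
    gcongr
  have hp' : (0 : ℝ) < p := by exact_mod_cast hp
  have hn2 : p + Real.log (1 / δ) ≤ n := by
    refine le_trans (le_mul_of_one_le_left (by positivity) ?_) hn1
    linarith
  have hn0 : (0 : ℝ) < n := lt_of_lt_of_le (by positivity) hn2
  have hf0 : 0 ≤ fbar := by
    obtain ⟨x, hx⟩ := hD.exists
    simpa using (abs_nonneg _).trans (hx.2.1 1)
  obtain ⟨hL, hL0, hLV⟩ := ESReg.memLp_centeredShortfall_smul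
    (W := ESReg.standardize P) (ESReg.continuous_mulVecE _).measurable hi2 hα0 hα1 hM hD
  rw [htr] at hLV
  obtain ⟨B₁, hB₁m, hB₁, hB₁b⟩ := ESReg.exists_norm_sum_sq_le
    (ESReg.measurable_centeredShortfall.smul hWm) hL hL0 (by positivity) hLV hδ n
  obtain ⟨B₂, hB₂m, hB₂, hB₂b⟩ := ESReg.exists_norm_sum_multSummand_le (n := n) hWm
    (ESReg.measurable_scaledShift α r₀ βs) (ESReg.abs_scaledShift_sub_le hα0 hα1 hr)
    (ESReg.scaledShift_zero r₀) hi2 hυ hsg hδ hδ1 hn2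
  obtain ⟨B₃, hB₃m, hB₃, hB₃b⟩ := ESReg.exists_half_le_sum_inner_sq (n := n) hWm hp hi4 hk0 hiso
    (ESReg.integral_inner_pow_four_le_kappa hi4) hδ hn1
  have hmap : μ.map (fun ω i => Z i ω) = Measure.pi fun _ : Fin n => P := by
    rw [hind.map_fun_eq_pi_map fun i => (hlaw i).aemeasurable]
    simp_rw [fun i => (hlaw i).map_eq]
  have hZ : AEMeasurable (fun ω i => Z i ω) μ :=
    aemeasurable_pi_lambda _ fun i => (hlaw i).aemeasurable
  have hpre : ∀ B : Set (Fin n → ESReg.Vec p × ℝ), MeasurableSet B →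
      Measure.pi (fun _ : Fin n => P) B ≤ ENNReal.ofReal δ →
      μ ((fun ω i => Z i ω) ⁻¹' B) ≤ ENNReal.ofReal δ := fun B hB h => by
    rwa [← Measure.map_apply_of_aemeasurable hZ hB, hmap]
  -- The estimators need not be measurable: off the measurable set $B_1\cup B_2\cup B_3$ of samples
  -- the bound is deterministic, so monotonicity of the outer measure is enough.
  have hsub : {ω | ESReg.matNorm (ESReg.secondMoment P) (βh ω - βs) ≤ r₀ ∧
      ¬ α * ESReg.matNorm (ESReg.secondMoment P) (θh ω - θs) ≤
        2 * σbar * √(p / (n * δ)) + fbar * ESReg.kappa P 3 * r₀ ^ 2 +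
          4640 * υ ^ 2 * √((p + Real.log (1 / δ)) / n) * r₀} ≤ᵐ[μ]
      (fun ω i => Z i ω) ⁻¹' (B₁ ∪ B₂ ∪ B₃) := by
    filter_upwards [hest] with ω hω hbad
    obtain ⟨hβ, hnot⟩ := hbad
    by_contra hmem
    have hmem' : (fun i => Z i ω) ∉ B₁ ∪ B₂ ∪ B₃ := hmem
    simp only [mem_union, not_or] at hmem'
    obtain ⟨⟨h1, h2⟩, h3⟩ := hmem'
    refine hnot ?_
    have hnoise : ‖∑ i, ESReg.centeredShortfall α βs θs (Z i ω) •
        ESReg.standardize P (Z i ω).1‖ ≤ √(n * (σbar ^ 2 * p) / δ) :=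
      Real.le_sqrt_of_sq_le (hB₁b _ h1)
    have hk3 : ∀ u v : ESReg.Vec p, ‖u‖ = 1 → ‖v‖ ≤ 1 →
        |inner ℝ u (∫ z, ESReg.multSummand W (ESReg.scaledShift α r₀ βs) z v ∂P)| ≤
          fbar * r₀ / 2 * ESReg.kappa P 3 := fun u v hu hv => by
      obtain ⟨hint, hle⟩ := ESReg.integral_abs_inner_mul_inner_sq_le hi4 hu hv
      refine (ESReg.abs_inner_integral_multSummand_le (W := ESReg.standardize P)
        (ESReg.continuous_mulVecE _).measurable hi2 hα0 hα1 hM hD hr u v hint).trans ?_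
      gcongr
    have hk30 : 0 ≤ ESReg.kappa P 3 := Real.iSup_nonneg fun u => integral_nonneg fun z => by
      positivity
    have hbound := ESReg.mul_matNorm_le (by exact_mod_cast hn0) hα0 hr hpos hω hβ
      (Real.sqrt_nonneg _) (by positivity) (hB₃b _ h3) hnoise (hB₂b _ h2) hk3
    refine hbound.trans_eq ?_
    -- The noise term; here $\bar\sigma\ge0$ is needed to extract the root.
    have e1 : 2 / n * √(n * (σbar ^ 2 * p) / δ) = 2 * σbar * √(p / (n * δ)) := by
      have : n * (σbar ^ 2 * p) / δ = (n * σbar) ^ 2 * (p / (n * δ)) := by field_simp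
      rw [this, Real.sqrt_mul (by positivity), Real.sqrt_sq (by positivity)]
      field_simp
    rw [e1]
    field_simp
    ring
  calc _ ≤ μ ((fun ω i => Z i ω) ⁻¹' (B₁ ∪ B₂ ∪ B₃)) := measure_mono_ae hsub
    _ ≤ μ ((fun ω i => Z i ω) ⁻¹' B₁) + μ ((fun ω i => Z i ω) ⁻¹' B₂)
        + μ ((fun ω i => Z i ω) ⁻¹' B₃) := by
        rw [preimage_union, preimage_union]
        exact (measure_union_le _ _).trans (by gcongr; exact measure_union_le _ _)
    _ ≤ ENNReal.ofReal δ + ENNReal.ofReal δ + ENNReal.ofReal δ := by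
        gcongr
        · exact hpre _ hB₁m hB₁
        · exact hpre _ hB₂m hB₂
        · exact hpre _ hB₃m hB₃
    _ = ENNReal.ofReal (3 * δ) := by
        rw [← ENNReal.ofReal_add hδ.le hδ.le, ← ENNReal.ofReal_add (by positivity) hδ.le]
        ring_nf
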